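/- Let $M\ge 1$, and let $k_1,\dots,k_M$, $L^{\mathrm I}_p,L^{\mathrm{II}}_p$ ($1\le p\le M-1$) and $L_M$ be non-negative integers. Take complex variables $x^{(p)}_a$ ($1\le p\le M$, $1\le a\le k_p$), $y^{(p)}_{\mathrm I,s}$ ($s\le L_p^{\mathrm I}$), $y^{(p)}_{\mathrm{II},s}$ ($s\le L_p^{\mathrm{II}}$) for $1\le p\le M-1$, and $y^{(M)}_s$ ($s\le L_M$), such that for each $p$ the numbers $x^{(p)}_1,\dots,x^{(p)}_{k_p}$ are pairwise distinct. Let $V=\mathbb C^{M+1}$ with basis $e_1,\dots,e_{M+1}$ (the colours) and matrix units $E_{ij}$, and $$R(x,y)=\sum_i (x-y+1)E_{ii}\otimes E_{ii}+\sum_{i\ne j}(x-y)E_{ii}\otimes E_{jj}+\sum_{i\neq j}E_{ij}\otimes E_{ji}.$$ **Lattice.** There is one copy of $V$ (a line) for every variable. Layer $p$ is a rectangular grid. Its horizontal lines are those of $x^{(p)}_1,\dots,x^{(p)}_{k_p}$, from top to bottom. Its vertical lines, from left to right, are those of $y^{(p)}_{\mathrm I,1},\dots,y^{(p)}_{\mathrm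 I,L_p^{\mathrm I}},x^{(p+1)}_1,\dots,x^{(p+1)}_{k_{p+1}},y^{(p)}_{\mathrm{II},1},\dots,y^{(p)}_{\mathrm{II},L_p^{\mathrm{II}}}$ if $p<M$, and $y^{(M)}_1,\dots,y^{(M)}_{L_M}$ if $p=M$. Each crossing of a horizontal line with variable $x$ and a vertical line with variable $y$ carries $R(x,y)$, acting on (horizontal)$\otimes$(vertical). After passing upwards through layer $p$, the lines of $x^{(p+1)}$ turn right without crossing each other and enter layer $p+1$ from the left. The $R$-matrices act layer by layer from $p=1$ to $p=M$, in each layer row by row from bottom to top, and in each row from left to right; let $T$ be the product. All vertical lines enter layer $p$ from below with colour $p+1$, the horizontal lines of layer $1$ enter from the left with colour $1$, and the horizontal lines of layer $p$ leave on the right with colour $p+1$. The lines of the $y$-variables (the sites) leave at the top of their layer with prescribed colours. The partition function $\psi$ is the corresponding matrix element of $T$. **Labels.** Number the sites $1,2,3,\dots$ in the order $\boldsymbol y^{(1)}_{\mathrm I},\dots,\boldsymbol y^{(M-1)}_{\mathrm I},\boldsymbol y^{(M)},\boldsymbol y^{(M-1)}_{\mathrm{II}},\dots,\boldsymbol y^{(1)}_{\mathrm{II}}$,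 and colour them so that each site of layer $p$ has a colour in $\{1,\dots,p+1\}$. Let $\boldsymbol I^{(p)}$ be the set of the (numbers of) sites in layers $p,\dots,M$ with colour in $\{1,\dots,p\}$, and assume $|\boldsymbol I^{(p)}|=k_p$ for all $1\le p\le M$. For $p<M$, relabel the sites in layers $p,\dots,M$ with colour in $\{1,\dots,p+1\}$ increasingly by $1,2,\dots,L_p^{\mathrm I}+k_{p+1}+L_p^{\mathrm{II}}$, and let $\widetilde I^{(p)}_1<\dots<\widetilde I^{(p)}_{k_p}$ be the image of $\boldsymbol I^{(p)}$. Let $I^{(M)}_1<\dots<I^{(M)}_{k_M}$ be the elements of $\boldsymbol I^{(M)}$, and put $\widetilde I^{(M)}_a=I^{(M)}_a-L_1^{\mathrm I}-\dots-L_{M-1}^{\mathrm I}$. **Weight function.** For $\sigma=(\sigma_1,\dots,\sigma_M)\in S_{k_1}\times\dots\times S_{k_M}$ and $p<M$, let $m^{(p)}=(m^{(p)}_1,\dots,m^{(p)}_{N_p})$ be the concatenation of $(y^{(p)}_{\mathrm I,s})_s$, $(x^{(p+1)}_{\sigma_{p+1}(b)})_b$ and $(y^{(p)}_{\mathrm{II},s})_s$;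 let $m^{(M)}=(y^{(M)}_1,\dots,y^{(M)}_{L_M})$ and $N_M=L_M$. The extended rational weight function is $$W=\sum_{\sigma}\prod_{p=1}^{M}\left\{\prod_{a=1}^{k_p}\left(\prod_{i=1}^{\widetilde I^{(p)}_a-1}\bigl(x^{(p)}_{\sigma_p(a)}-m^{(p)}_i\bigr)\prod_{i=\widetilde I^{(p)}_a+1}^{N_p}\bigl(x^{(p)}_{\sigma_p(a)}-m^{(p)}_i+1\bigr)\right)\prod_{1\le a<b\le k_p}\frac{x^{(p)}_{\sigma_p(a)}-x^{(p)}_{\sigma_p(b)}-1}{x^{(p)}_{\sigma_p(a)}-x^{(p)}_{\sigma_p(b)}}\right\}.$$ **Theorem.** $\psi=W$. -/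

import Mathlib

open scoped Kronecker

noncomputable section

namespace GLPartition

/-- The discrete sizes of a lattice with `M = n + 1` layers.  Layers are numbered from `0` (bottom
left) to `n` (top right), so layer `p` here is layer `p + 1` in the usual numbering.
`k p` is the number of auxiliary lines of layer `p`; a layer `p < n` has `LI p` left and `LII p`
right extra quantum lines, and the top layer has `LM` quantum lines. -/
structure Shape (n : ℕ) where
  k : Fin (n + 1) → ℕ
  LI : Fin n → ℕ
  LII : Fin n → ℕ
  LM : ℕ

/-- The spectral variables. -/
structure Spectral {n : ℕ} (S : Shape n) where
  x : (p : Fin (n + 1)) → Fin (S.k p) → ℂ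
  yI : (p : Fin n) → Fin (S.LI p) → ℂ
  yII : (p : Fin n) → Fin (S.LII p) → ℂ
  y : Fin S.LM → ℂ

/-- Colours of `gl_{M+1}`, `M = n + 1`: the element `i : Fin (n + 2)` is the colour `i + 1`. -/
abbrev Colour (n : ℕ) : Type := Fin (n + 2)

/-! ### Lines of the lattice -/

/-- The quantum lines that end at the top of a layer and carry a coloured circle there. -/
inductive Site {n : ℕ} (S : Shape n) : Type
  | left (p : Fin n) (s : Fin (S.LI p))
  | top (s : Fin S.LM)
  | right (p : Fin n) (s : Fin (S.LII p))
  deriving DecidableEq, Fintype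

/-- All lines of the lattice.  The line `aux p a` is the auxiliary (horizontal) line of layer `p`
with variable `x p a`; for `p = q + 1` the same line runs vertically, as a quantum line, through
layer `q` before it turns to the right and enters layer `p` from the left. -/
inductive Line {n : ℕ} (S : Shape n) : Type
  | aux (p : Fin (n + 1)) (a : Fin (S.k p))
  | site (s : Site S)
  deriving DecidableEq, Fintype

variable {n : ℕ} {S : Shape n}

/-- The layer at whose top a site ends. -/
def Site.layer : Site S → Fin (n + 1)
  | .left p _ => p.castSucc
  | .top _ => Fin.last n
  | .right p _ => p.castSucc

/-- The coordinate (numbered from `1`) of a site, in the order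
`yI^(1), …, yI^(M-1), y^(M), yII^(M-1), …, yII^(1)`. -/
def Site.coord : Site S → ℕ
  | .left p s => (∑ q ∈ Finset.Iio p, S.LI q) + s + 1
  | .top s => (∑ q, S.LI q) + s + 1
  | .right p s => (∑ q, S.LI q) + S.LM + (∑ q ∈ Finset.Ioi p, S.LII q) + s + 1

/-- The spectral variable of a line. -/
def Spectral.var (X : Spectral S) : Line S → ℂ
  | .aux p a => X.x p a
  | .site (.left p s) => X.yI p s
  | .site (.top s) => X.y s
  | .site (.right p s) => X.yII p s

/-! ### The R-matrix and the partition function -/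

/-- Matrix unit `E_{ij}`. -/
def E (i j : Colour n) : Matrix (Colour n) (Colour n) ℂ := Matrix.single i j 1

variable (n) in
/-- The rational R-matrix on `V ⊗ V`, `V = ℂ^{n+2}`. -/
def R (x y : ℂ) : Matrix (Colour n × Colour n) (Colour n × Colour n) ℂ :=
  (∑ i : Colour n, (x - y + 1) • (E i i ⊗ₖ E i i))
    + (∑ i : Colour n, ∑ j ∈ Finset.univ.filter (fun j => i ≠ j), (x - y) • (E i i ⊗ₖ E j j))
    + ∑ i : Colour n, ∑ j ∈ Finset.univ.filter (fun j => i ≠ j), E i j ⊗ₖ E j i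

/-- A matrix `A` on `V ⊗ V` acting on the factors `u`, `v` (in this order) of the tensor product
`⨂_{lines} V`, and as the identity on all other factors. -/
def onLines (u v : Line S) (A : Matrix (Colour n × Colour n) (Colour n × Colour n) ℂ) :
    Matrix (Line S → Colour n) (Line S → Colour n) ℂ :=
  Matrix.of fun σ τ =>
    if ∀ w, w ≠ u → w ≠ v → σ w = τ w then A (σ u, σ v) (τ u, τ v) else 0

/-- The vertical lines of a layer, from left to right. -/
def columns (S : Shape n) (p : Fin (n + 1)) : List (Line S) :=
  Fin.lastCases (motive := fun _ => List (Line S))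
    ((List.finRange S.LM).map fun s => Line.site (Site.top s))
    (fun q =>
      ((List.finRange (S.LI q)).map fun s => Line.site (Site.left q s))
        ++ ((List.finRange (S.k q.succ)).map fun a => Line.aux q.succ a)
        ++ ((List.finRange (S.LII q)).map fun s => Line.site (Site.right q s)))
    p

/-- The vertices (horizontal line, vertical line) of a layer, row by row from the bottom row to
the top row and from left to right in each row.  Since the vertical lines turn to the right without
crossing each other, the auxiliary lines `1, …, k p` are ordered from top to bottom. -/
def layerVertices (S : Shape n) (p : Fin (n + 1)) : List (Line S × Line S) :=
  (List.finRange (S.k p)).reverse.flatMap fun a => (columns S p).map fun v => (Line.aux p a, v)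

/-- All vertices of the lattice, from the bottom layer to the top layer. -/
def vertices (S : Shape n) : List (Line S × Line S) :=
  (List.finRange (n + 1)).flatMap (layerVertices S)

/-- The product of the R-matrices of all vertices; the first vertex of the list acts first,
i.e. is the rightmost factor. -/
def latticeOperator (X : Spectral S) : Matrix (Line S → Colour n) (Line S → Colour n) ℂ :=
  ((vertices S).reverse.map fun g =>
    onLines g.1 g.2 (R n (X.var g.1) (X.var g.2))).prod

/-- Incoming colours: all vertical lines enter layer `p` from below with the same colour (`2` in
the bottom layer, then `3`, …, and `M + 1` in the top layer), and the auxiliary lines of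
the bottom layer enter from the left with colour `1`. -/
def inState (S : Shape n) : Line S → Colour n
  | .aux p _ => p.castSucc
  | .site s => s.layer.succ

/-- Outgoing colours: the auxiliary lines leave the bottom layer on the right with colour `2`, the
next one with colour `3`, …, and the top layer with colour `M + 1`; the sites are contracted with
the prescribed colours. -/
def outState (c : Site S → Colour n) : Line S → Colour n
  | .aux p _ => p.succ
  | .site s => c s

/-- The rational partition function. -/
def psi (X : Spectral S) (c : Site S → Colour n) : ℂ :=
  latticeOperator X (outState c) (inState S)

/-! ### Labels of configurations -/

/-- The set `I^(p)`: coordinates in layers `≥ p` with one of the first `p` colours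
(layers in the usual numbering). -/
def labelSet (c : Site S → Colour n) (p : Fin (n + 1)) : Finset ℕ :=
  (Finset.univ.filter fun s : Site S => p ≤ s.layer ∧ c s ≤ p.castSucc).image Site.coord

/-- Coordinates in layers `≥ p` with one of the first `p + 1` colours. -/
def keptSet (c : Site S → Colour n) (p : Fin (n + 1)) : Finset ℕ :=
  (Finset.univ.filter fun s : Site S => p ≤ s.layer ∧ c s ≤ p.succ).image Site.coord

/-- The induced set: the image of `I^(p)` under the order preserving relabelling of `keptSet` by
`1, 2, 3, …`. -/
def inducedSet (c : Site S → Colour n) (p : Fin (n + 1)) : Finset ℕ :=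
  (labelSet c p).image fun t => ((keptSet c p).filter fun u => u ≤ t).card

/-- The `a`-th element, in increasing order and with `a` counted from `0`, of a finite set that has
more than `a` elements. -/
def nthElement (A : Finset ℕ) (a : ℕ) : ℕ := Nat.nth (fun t => t ∈ A) a

/-- A colouring is admissible if a site of layer `p` has one of the first `p + 1` colours
(layers in the usual numbering) and `|I^(p)| = k_p` for all `p`. -/
structure Admissible (c : Site S → Colour n) : Prop where
  colour_le : ∀ s, c s ≤ s.layer.succ
  card_labelSet : ∀ p, (labelSet c p).card = S.k p

/-! ### The extended rational weight function -/

/-- The factor of one layer: auxiliary variables `x`, quantum variables `m` (from left to right)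
and positions `I a ∈ {1, …, N}`. -/
def layerFactor {k N : ℕ} (x : Fin k → ℂ) (m : Fin N → ℂ) (I : Fin k → ℕ) : ℂ :=
  (∏ a : Fin k,
      ((∏ i ∈ Finset.univ.filter (fun i : Fin N => (i : ℕ) + 1 < I a), (x a - m i))
        * ∏ i ∈ Finset.univ.filter (fun i : Fin N => I a < (i : ℕ) + 1), (x a - m i + 1)))
    * ∏ a : Fin k, ∏ b ∈ Finset.Ioi a, (x a - x b - 1) / (x a - x b)

/-- The extended rational weight function. -/
def weightFunction (X : Spectral S) (c : Site S → Colour n) : ℂ :=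
  ∑ σ : (p : Fin (n + 1)) → Equiv.Perm (Fin (S.k p)),
    (∏ p : Fin n,
        layerFactor (fun a => X.x p.castSucc (σ p.castSucc a))
          (Fin.append (Fin.append (X.yI p) (fun b => X.x p.succ (σ p.succ b))) (X.yII p))
          (fun a => nthElement (inducedSet c p.castSucc) a))
      * layerFactor (fun a => X.x (Fin.last n) (σ (Fin.last n) a)) X.y
          (fun a => nthElement (labelSet c (Fin.last n)) a - ∑ q, S.LI q)

end GLPartition

end

open scoped Kronecker

noncomputable section

/-! This is the nested algebraic Bethe ansatz carried out on the lattice. Since R(x, y) = (x - y) +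
P, each vertex either lets two colours pass or swaps them. All vertical lines of a layer enter with
one colour d, so the Yang-Baxter equation yields relation `Exchange` for a partial partition
function viewed as a function of the ordered list of (variable, colour) pairs of adjacent lines. It
holds for rows (`Exchange.layerWeight`) and for the columns of a finished layer
(`layerWeight_exchange`).

Peel the columns of a layer off from the right, all rows leaving with d. A column that ends with d
is frozen. A column that ends with c ≠ d must have received c from a row; `Exchange` moves that row
below the remaining d-rows, and wanted and unwanted terms combine into one sum over the row t, with
coefficient ∏ (b - y + 1)(t - b + 1)/(t - b) (`Exchange.column_particle`). The successive choices
form a permutation and the coefficients multiply to `layerFactor` (`Exchange.layerWeight_eq_sum`).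

What is left is the weight of the layers below, their outgoing lines x^(p) being listed in permuted
order with the colours of the columns that do not end with d. This is a function of the same type,
so the expansion repeats from the top layer downwards (`lowerWeight_succ_labelSite`), until only
colour 1 remains and the weight is 1. `sum_chain` collects the nested sums. The rest identifies the
matrix product with the column recursion, and the label sets with the positions of the columns that
do not end with d. -/

namespace GLPartition

/-! ### Exchange relations and the evaluation of a single column. -/

section Exchange

variable {C : Type*}

/-- The exchange relation satisfied by functions of an ordered sequence of lines, each of which
carries a spectral variable and a colour. -/
def Exchange (F : List (ℂ × C) → ℂ) : Prop :=
  ∀ l₁ l₂ x y α β,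
    (x - y) * F (l₁ ++ (x, α) :: (y, β) :: l₂) + F (l₁ ++ (x, β) :: (y, α) :: l₂)
      = (x - y + 1) * F (l₁ ++ (y, β) :: (x, α) :: l₂)

variable {d : C} {F G : List (ℂ × C) → ℂ}

theorem Exchange.cons (hF : Exchange F) (e : ℂ × C) : Exchange fun l => F (e :: l) :=
  fun l₁ l₂ x y α β => hF (e :: l₁) l₂ x y α β

/-- The sum of `g t l` over all ways to take one element `t` out of a list, leaving `l`. -/
def sumErase (g : ℂ → List ℂ → ℂ) : List ℂ → ℂ
  | [] => 0
  | x :: xs => g x xs + sumErase (fun t l => g t (x :: l)) xs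

theorem sumErase_congr {g h : ℂ → List ℂ → ℂ} {xs : List ℂ}
    (H : ∀ t l, (t :: l).Perm xs → g t l = h t l) : sumErase g xs = sumErase h xs := by
  induction xs generalizing g h with
  | nil => rfl
  | cons x xs ih =>
    simp only [sumErase]
    rw [H x xs (List.Perm.refl _), ih]
    intro t l hp
    exact H _ _ ((List.Perm.swap x t l).trans (hp.cons x))

theorem sumErase_linear (a b : ℂ) (g h : ℂ → List ℂ → ℂ) (xs : List ℂ) :
    sumErase (fun t l => a * g t l + b * h t l) xs = a * sumErase g xs + b * sumErase h xs := by
  induction xs generalizing g h with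
  | nil => simp [sumErase]
  | cons x xs ih => simp only [sumErase, ih]; ring

theorem sumErase_ofFn (g : ℂ → List ℂ → ℂ) {r : ℕ} (x : Fin (r + 1) → ℂ) :
    sumErase g (List.ofFn x) = ∑ i, g (x i) (List.ofFn fun j => x (i.succAbove j)) := by
  induction r generalizing g with
  | zero => simp [sumErase]
  | succ r ih =>
    rw [List.ofFn_succ, sumErase, ih, Fin.sum_univ_succ (n := r + 1)]
    have h : ∀ i : Fin (r + 1), (List.ofFn fun j => x (i.succ.succAbove j))
        = x 0 :: List.ofFn fun j => x (i.succAbove j).succ := fun i => by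
      rw [List.ofFn_succ]
      simp only [Fin.succ_succAbove_zero, Fin.succ_succAbove_succ]
    simp only [h, Fin.succAbove_zero]

/-- The Bethe ansatz commutation rule: the wanted term carries z to the end, an unwanted term leaves
z with colour d and gives c to another variable t. Distinctness enters because the two-line relation
is divided by a difference of variables. -/
theorem Exchange.move_right (hF : Exchange F) (c : C) (l : List (ℂ × C)) {z : ℂ} {xs : List ℂ}
    (hz : (z :: xs).Nodup) :
    F ((z, c) :: (xs.map (·, d) ++ l))
      = (xs.map fun b => (z - b + 1) / (z - b)).prod * F (xs.map (·, d) ++ (z, c) :: l)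
        + sumErase (fun t s => 1 / (t - z) * (s.map fun b => (t - b + 1) / (t - b)).prod
            * F ((z, d) :: (s.map (·, d) ++ (t, c) :: l))) xs := by
  induction xs generalizing F z with
  | nil => simp [sumErase]
  | cons w xs ih =>
    have hzw : z ≠ w := fun h => by simp [h] at hz
    have hzxs : (z :: xs).Nodup := hz.sublist (by simp)
    have hwxs : (w :: xs).Nodup := (List.nodup_cons.mp hz).2
    have hzw' : z - w ≠ 0 := sub_ne_zero.mpr hzw
    have hwz' : w - z ≠ 0 := sub_ne_zero.mpr hzw.symm
    -- Exchanging z with its neighbour w leaves c on z behind w, or on w behind z; induction moves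
    -- it on in both cases. The wanted term of the second case is the unwanted term t = w.
    have e := hF [] (xs.map (·, d) ++ l) z w c d
    have h₁ := ih (hF.cons (w, d)) hzxs
    have h₂ := ih (hF.cons (z, d)) hwxs
    simp only [List.nil_append] at e
    rw [h₁, h₂] at e
    simp only [List.map_cons, List.cons_append, sumErase, List.prod_cons]
    have hs := sumErase_linear ((z - w + 1) / (z - w)) (-1 / (z - w))
      (fun t s => 1 / (t - z) * (s.map fun b => (t - b + 1) / (t - b)).prod
            * F ((w, d) :: (z, d) :: (s.map (·, d) ++ (t, c) :: l)))
      (fun t s => 1 / (t - w) * (s.map fun b => (t - b + 1) / (t - b)).prod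
            * F ((z, d) :: (w, d) :: (s.map (·, d) ++ (t, c) :: l))) xs
    have hc : sumErase (fun t s => 1 / (t - z) * ((t - w + 1) / (t - w)
          * (s.map fun b => (t - b + 1) / (t - b)).prod)
            * F ((z, d) :: (w, d) :: (s.map (·, d) ++ (t, c) :: l))) xs = _ :=
      (sumErase_congr fun t s hp => ?_).trans hs
    · rw [hc]
      have : F ((z, c) :: (w, d) :: (xs.map (·, d) ++ l)) * (z - w) / (z - w) = _ :=
        mul_div_cancel_right₀ _ hzw'
      rw [← this, mul_comm _ (z - w), eq_sub_of_add_eq e, ← neg_sub z w]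
      field_simp
      ring
    · have ht : t ∈ xs := hp.subset (by simp)
      have htz : t - z ≠ 0 := sub_ne_zero.mpr fun h => (List.nodup_cons.mp hzxs).1 (h ▸ ht)
      have htw : t - w ≠ 0 := sub_ne_zero.mpr fun h => (List.nodup_cons.mp hwxs).1 (h ▸ ht)
      -- For equal colours the relation says (z - w + 1) A = (z - w + 1) B. The factor may vanish
      -- and is never cancelled.
      have e := hF [] (s.map (·, d) ++ (t, c) :: l) z w d d
      simp only [List.nil_append] at e
      set P := (s.map fun b => (t - b + 1) / (t - b)).prod
      set A := F ((z, d) :: (w, d) :: (s.map (·, d) ++ (t, c) :: l))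
      set B := F ((w, d) :: (z, d) :: (s.map (·, d) ++ (t, c) :: l))
      field_simp
      linear_combination P * (t - w) * e

variable [DecidableEq C]

/-- One column of the lattice with vertical variable `y`, which enters from below with colour `d`
and leaves at the top with colour `c`.  The argument `F` is the weight of the part of the lattice
to the left, as a function of the horizontal lines from top to bottom. -/
def column (d : C) (y : ℂ) : C → (List (ℂ × C) → ℂ) → List (ℂ × C) → ℂ
  | c, F, [] => if c = d then F [] else 0
  | c, F, (x, α) :: l =>
      (x - y) * column d y c (fun l' => F ((x, α) :: l')) l
        + column d y α (fun l' => F ((x, c) :: l')) l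

/-- A layer of the lattice, as a function of its columns (from left to right) and of its rows
(from top to bottom). -/
def layerWeight (d : C) : (List (ℂ × C) → ℂ) → List (ℂ × C) → List (ℂ × C) → ℂ
  | F, [] => F
  | F, v :: m => layerWeight d (column d v.1 v.2 F) m

theorem column_linear (y a b : ℂ) (c : C) (F G : List (ℂ × C) → ℂ) (l : List (ℂ × C)) :
    column d y c (fun l' => a * F l' + b * G l') l
      = a * column d y c F l + b * column d y c G l := by
  induction l generalizing c F G with
  | nil => simp only [column]; split_ifs <;> ring
  | cons e l ih =>
    obtain ⟨x, α⟩ := e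
    simp only [column, ih]
    ring

theorem layerWeight_linear (a b : ℂ) (F G : List (ℂ × C) → ℂ) (m l : List (ℂ × C)) :
    layerWeight d (fun l' => a * F l' + b * G l') m l
      = a * layerWeight d F m l + b * layerWeight d G m l := by
  induction m generalizing F G with
  | nil => rfl
  | cons v m ih =>
    simp only [layerWeight]
    rw [← ih]
    congr 1
    funext l'
    exact column_linear _ _ _ _ _ _ _

theorem layerWeight_append (F : List (ℂ × C) → ℂ) (m m' : List (ℂ × C)) :
    layerWeight d F (m ++ m') = layerWeight d (layerWeight d F m) m' := by
  induction m generalizing F with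
  | nil => rfl
  | cons v m ih => exact ih _

/-- The Yang-Baxter equation for two adjacent rows and one vertical line, in components. -/
theorem Exchange.column (hF : Exchange F) (y : ℂ) (c : C) : Exchange (column d y c F) := by
  intro l₁
  induction l₁ generalizing F c with
  | nil =>
    intro l x z α β
    -- γ is the colour of the vertical line just below the two rows; a and b are the colours with
    -- which the rows come out of `F`.
    have key : ∀ γ a b,
        (x - z) * GLPartition.column d y γ (fun l' => F ((x, a) :: (z, b) :: l')) l
          + GLPartition.column d y γ (fun l' => F ((x, b) :: (z, a) :: l')) l
        = (x - z + 1) * GLPartition.column d y γ (fun l' => F ((z, b) :: (x, a) :: l')) l := by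
      intro γ a b
      have h := column_linear (d := d) y (x - z) 1 γ (fun l' => F ((x, a) :: (z, b) :: l'))
        (fun l' => F ((x, b) :: (z, a) :: l')) l
      have h' := column_linear (d := d) y (x - z + 1) 0 γ (fun l' => F ((z, b) :: (x, a) :: l'))
        (fun _ => 0) l
      rw [one_mul] at h
      rw [← h, ← add_zero ((x - z + 1) * _),
        ← zero_mul (GLPartition.column d y γ (fun _ => 0) l), ← h']
      congr 1
      funext l'
      simpa using hF [] l' x z a b
    simp only [List.nil_append, GLPartition.column]
    linear_combination (x - y) * (z - y) * key c α β + (z - y) * key α c β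
      + (x - y) * key β α c + key α β c
  | cons e l₁ ih =>
    obtain ⟨w, γ⟩ := e
    intro l x z α β
    have h₁ := ih (hF.cons (w, γ)) c l x z α β
    have h₂ := ih (hF.cons (w, c)) γ l x z α β
    simp only [List.cons_append, GLPartition.column]
    linear_combination (w - y) * h₁ + h₂

theorem Exchange.layerWeight (hF : Exchange F) (m : List (ℂ × C)) :
    Exchange (layerWeight d F m) := by
  induction m generalizing F with
  | nil => exact hF
  | cons v m ih => exact ih (hF.column _ _)

/-- Yang-Baxter for two adjacent columns. It closes because both enter with the same colour d, on
which the R-matrix acts by the eigenvalue y - z + 1. -/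
theorem column_column_exchange (y z : ℂ) (F : List (ℂ × C) → ℂ) (α β : C) (l : List (ℂ × C)) :
    (y - z) * column d z β (column d y α F) l + column d z α (column d y β F) l
      = (y - z + 1) * column d y α (column d z β F) l := by
  induction l generalizing F α β with
  | nil => simp only [column]; split_ifs <;> ring
  | cons e l ih =>
    obtain ⟨x, γ⟩ := e
    have lin : ∀ (a : ℂ) (y z : ℂ) (β : C) (F G : List (ℂ × C) → ℂ),
        column d z β (fun l' => a * F l' + G l') l
          = a * column d z β F l + column d z β G l := by
      intro a y z β F G
      simpa using column_linear (d := d) z a 1 β F G l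
    simp only [column, lin _ y]
    have h₁ := ih (fun l' => F ((x, γ) :: l')) α β
    have h₂ := ih (fun l' => F ((x, α) :: l')) γ β
    have h₃ := ih (fun l' => F ((x, β) :: l')) α γ
    have h₄ := ih (fun l' => F ((x, α) :: l')) β γ
    have h₅ := ih (fun l' => F ((x, β) :: l')) γ α
    linear_combination (x - y) * (x - z) * h₁ + (x - z) * h₂ + (x - y) * h₃ + h₅

/-- This makes the nesting possible: the rows of the next layer are adjacent columns of this one, so
the weight of this layer is again an admissible input for `Exchange.layerWeight_eq_sum`. -/
theorem layerWeight_exchange (F : List (ℂ × C) → ℂ) (A B rows : List (ℂ × C)) :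
    Exchange fun l => layerWeight d F (A ++ l ++ B) rows := by
  intro l₁ l₂ x y α β
  simp only [layerWeight_append, layerWeight]
  set G := layerWeight d (layerWeight d F A) l₁
  have h : (fun l => (x - y) * column d y β (column d x α G) l
      + 1 * column d y α (column d x β G) l)
      = fun l => (x - y + 1) * column d x α (column d y β G) l + 0 * (fun _ => (0 : ℂ)) l := by
    funext l
    simpa using column_column_exchange x y G α β l
  have h₂ := congrArg (fun H => layerWeight d (layerWeight d H l₂) B rows) h
  have lin : ∀ (a b : ℂ) (F G : List (ℂ × C) → ℂ) (m : List (ℂ × C)),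
      layerWeight d (fun l' => a * F l' + b * G l') m
        = fun l => a * layerWeight d F m l + b * layerWeight d G m l :=
    fun a b F G m => funext fun l => layerWeight_linear a b F G m l
  simp only [lin] at h₂
  simpa using h₂

theorem exchange_indicator (i : C) :
    Exchange fun l : List (ℂ × C) => if ∀ e ∈ l, e.2 = i then (1 : ℂ) else 0 := by
  intro l₁ l₂ x y α β
  have h : ∀ x y (α β : C), (∀ e ∈ l₁ ++ (x, α) :: (y, β) :: l₂, e.2 = i) ↔
      ((∀ e ∈ l₁, e.2 = i) ∧ (∀ e ∈ l₂, e.2 = i)) ∧ α = i ∧ β = i := by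
    intro x y α β
    simp only [List.mem_append, List.mem_cons]
    constructor
    · intro h
      exact ⟨⟨fun e he => h e (.inl he), fun e he => h e (.inr (.inr (.inr he)))⟩,
        h (x, α) (.inr (.inl rfl)), h (y, β) (.inr (.inr (.inl rfl)))⟩
    · rintro ⟨⟨h₁, h₂⟩, h₃, h₄⟩ e (he | rfl | rfl | he)
      exacts [h₁ e he, h₃, h₄, h₂ e he]
  simp only [h]
  by_cases hα : α = i <;> by_cases hβ : β = i <;>
    simp only [hα, hβ, and_true, and_false, if_false] <;> (try split_ifs) <;> ring

/-! ### Evaluation of one column -/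

/-- Colour conservation: the d that enters from below has to leave somewhere. -/
theorem column_eq_zero {y : ℂ} {c : C} (hc : c ≠ d) (F : List (ℂ × C) → ℂ) {l : List (ℂ × C)}
    (hl : ∀ e ∈ l, e.2 ≠ d) : column d y c F l = 0 := by
  induction l generalizing c F with
  | nil => simp [column, hc]
  | cons e l ih =>
    obtain ⟨x, α⟩ := e
    have hl' : ∀ e ∈ l, e.2 ≠ d := fun e he => hl e (by simp [he])
    have hα : α ≠ d := hl (x, α) (by simp)
    simp [column, ih hc _ hl', ih hα _ hl']

/-- By colour conservation the vertical line keeps d along the bottom rows `l`, with weight x - y;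
at a d-row the two terms of R coincide and add up to x - y + 1. -/
theorem column_vacuum (y : ℂ) (F : List (ℂ × C) → ℂ) (xs : List ℂ) {l : List (ℂ × C)}
    (hl : ∀ e ∈ l, e.2 ≠ d) :
    column d y d F (xs.map (·, d) ++ l)
      = (xs.map fun x => x - y + 1).prod * (l.map fun e => e.1 - y).prod
          * F (xs.map (·, d) ++ l) := by
  induction xs generalizing F with
  | nil =>
    simp only [List.map_nil, List.nil_append, List.prod_nil, one_mul]
    induction l generalizing F with
    | nil => simp [column]
    | cons e l ih =>
      obtain ⟨x, α⟩ := e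
      have hl' : ∀ e ∈ l, e.2 ≠ d := fun e he => hl e (by simp [he])
      have hα : α ≠ d := hl (x, α) (by simp)
      simp [column, ih hl', column_eq_zero hα _ hl', mul_assoc]
  | cons x xs ih =>
    simp only [List.map_cons, List.cons_append, column, ih, List.prod_cons]
    ring

theorem Exchange.column_particle (hF : Exchange F) {y : ℂ} {c : C} (hc : c ≠ d)
    {xs : List ℂ} (hxs : xs.Nodup) {l : List (ℂ × C)} (hl : ∀ e ∈ l, e.2 ≠ d) :
    GLPartition.column d y c F (xs.map (·, d) ++ l)
      = (l.map fun e => e.1 - y).prod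
        * sumErase (fun t s => (s.map fun b => (b - y + 1) * ((t - b + 1) / (t - b))).prod
            * F (s.map (·, d) ++ (t, c) :: l)) xs := by
  induction xs generalizing F with
  | nil => simp [sumErase, column_eq_zero hc _ hl]
  | cons z xs ih =>
    have hz : xs.Nodup := (List.nodup_cons.mp hxs).2
    simp only [List.map_cons, List.cons_append, GLPartition.column, sumErase, List.prod_cons]
    -- Either c crosses the top row z unchanged, or it comes in along z; then the column is frozen
    -- below z and c is moved down past the d-rows.
    rw [ih (hF.cons (z, d)) hz, column_vacuum _ _ _ hl, hF.move_right c l hxs]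
    set P := (l.map fun e => e.1 - y).prod
    set Y := (xs.map fun x => x - y + 1).prod with hY
    have hs := sumErase_linear (z - y) Y
      (fun t s => (s.map fun b => (b - y + 1) * ((t - b + 1) / (t - b))).prod
        * F ((z, d) :: (s.map (·, d) ++ (t, c) :: l)))
      (fun t s => 1 / (t - z) * (s.map fun b => (t - b + 1) / (t - b)).prod
            * F ((z, d) :: (s.map (·, d) ++ (t, c) :: l))) xs
    have hcg : sumErase (fun t s => (z - y + 1) * ((t - z + 1) / (t - z))
          * (s.map fun b => (b - y + 1) * ((t - b + 1) / (t - b))).prod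
            * F ((z, d) :: (s.map (·, d) ++ (t, c) :: l))) xs = _ :=
      (sumErase_congr fun t s hp => ?_).trans hs
    · rw [hcg, List.prod_map_mul, ← hY]
      ring
    · have ht : t ∈ xs := hp.subset (by simp)
      have htz : t - z ≠ 0 := sub_ne_zero.mpr fun h => (List.nodup_cons.mp hxs).1 (h ▸ ht)
      -- The two contributions to t merge by (z - y) + (t - y + 1)/(t - z) = (z - y + 1)(t - z +
      -- 1)/(t - z).
      have hYt : Y = (t - y + 1) * (s.map fun x => x - y + 1).prod := by
        rw [hY, ← (hp.map fun x => x - y + 1).prod_eq, List.map_cons, List.prod_cons]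
      rw [hYt, List.prod_map_mul]
      field_simp
      ring

end Exchange

/-! ### Evaluation of a whole layer as a sum over permutations. -/

section LayerSum

/-- A permutation of `Fin (r + 1)` from the image of the last element and a permutation of `Fin r`. -/
def permOfLast {r : ℕ} (q : Fin (r + 1) × Equiv.Perm (Fin r)) : Equiv.Perm (Fin (r + 1)) :=
  finSuccEquivLast.trans ((Equiv.optionCongr q.2).trans (finSuccEquiv' q.1).symm)

theorem permOfLast_last {r : ℕ} (q : Fin (r + 1) × Equiv.Perm (Fin r)) :
    permOfLast q (Fin.last r) = q.1 := by
  simp [permOfLast]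

theorem permOfLast_castSucc {r : ℕ} (q : Fin (r + 1) × Equiv.Perm (Fin r)) (j : Fin r) :
    permOfLast q j.castSucc = q.1.succAbove (q.2 j) := by
  simp [permOfLast]

theorem permOfLast_bijective (r : ℕ) : Function.Bijective (permOfLast (r := r)) := by
  rw [Fintype.bijective_iff_injective_and_card]
  refine ⟨fun q q' h => ?_, ?_⟩
  · have h₁ : q.1 = q'.1 := by rw [← permOfLast_last q, h, permOfLast_last]
    refine Prod.ext h₁ (Equiv.ext fun j => ?_)
    have h₂ : q.1.succAbove (q.2 j) = q'.1.succAbove (q'.2 j) := by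
      rw [← permOfLast_castSucc q, h, permOfLast_castSucc]
    rw [h₁] at h₂
    exact Fin.succAbove_right_injective h₂
  · simp [Fintype.card_perm, Nat.factorial_succ]

theorem sum_perm_succ {A : Type*} {r : ℕ} (g : (Fin (r + 1) → A) → ℂ) (x : Fin (r + 1) → A) :
    ∑ π : Equiv.Perm (Fin (r + 1)), g (fun j => x (π j))
      = ∑ i, ∑ π : Equiv.Perm (Fin r),
          g (Fin.snoc (fun j => x (i.succAbove (π j))) (x i)) := by
  rw [← Fintype.sum_prod_type', ← (permOfLast_bijective r).sum_comp]
  refine Finset.sum_congr rfl fun q _ => congrArg g (funext fun j => ?_)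
  refine Fin.lastCases ?_ (fun j => ?_) j
  · simp [permOfLast_last]
  · simp [permOfLast_castSucc]

/-- `layerFactor` as a product over all indices, with the positions counted from `0`. -/
theorem layerFactor_eq {k N : ℕ} (x : Fin k → ℂ) (m : Fin N → ℂ) (J : Fin k → ℕ) :
    layerFactor x m (fun a => J a + 1)
      = (∏ a, ∏ i : Fin N, ((if (i : ℕ) < J a then x a - m i else 1)
            * if J a < (i : ℕ) then x a - m i + 1 else 1))
        * ∏ a : Fin k, ∏ b : Fin k, if a < b then (x a - x b - 1) / (x a - x b) else 1 := by
  simp only [layerFactor, Finset.prod_mul_distrib, Finset.prod_filter, add_lt_add_iff_right]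
  congr 1
  refine Finset.prod_congr rfl fun a _ => ?_
  rw [← Finset.prod_filter]
  refine Finset.prod_congr ?_ fun _ _ => rfl
  ext b
  simp

/-- Matches `column_vacuum`: the last column lies to the right of every position. -/
theorem layerFactor_vacuum {k N : ℕ} (x : Fin k → ℂ) (m : Fin (N + 1) → ℂ) (J : Fin k → ℕ)
    (hJ : ∀ a, J a < N) :
    layerFactor x m (fun a => J a + 1)
      = layerFactor x (fun i : Fin N => m i.castSucc) (fun a => J a + 1)
        * ∏ a, (x a - m (Fin.last N) + 1) := by
  simp only [layerFactor_eq, Fin.prod_univ_castSucc (n := N)]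
  rw [Finset.prod_mul_distrib (s := Finset.univ) (g := fun a => _ * _)]
  have : ∀ a, ¬ N < J a := fun a => (hJ a).not_gt
  simp [hJ, this]
  ring

/-- Matches `Exchange.column_particle`: z occupies the last column, so all earlier columns lie to
its left and every other row has its position before the last column. -/
theorem layerFactor_particle {k N : ℕ} (x : Fin k → ℂ) (z : ℂ) (m : Fin (N + 1) → ℂ)
    (J : Fin (k + 1) → ℕ) (hJ : ∀ a : Fin k, J a.castSucc < N) (hl : J (Fin.last k) = N) :
    layerFactor (Fin.snoc x z : Fin (k + 1) → ℂ) m (fun a => J a + 1)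
      = layerFactor x (fun i : Fin N => m i.castSucc) (fun a => J a.castSucc + 1)
        * (∏ i : Fin N, (z - m i.castSucc))
        * (∏ a, (x a - m (Fin.last N) + 1))
        * ∏ a, (x a - z - 1) / (x a - z) := by
  have h₁ : ∀ a : Fin k, ¬ N < J a.castSucc := fun a => (hJ a).not_gt
  have h₂ : ∀ i : Fin N, ¬ N < (i : ℕ) := fun i => i.2.not_gt
  have h₃ : ∀ a : Fin k, ¬ Fin.last k < a.castSucc := fun a => (Fin.castSucc_lt_last a).not_gt
  have h₄ : ∀ a : Fin k, a.castSucc < Fin.last k := Fin.castSucc_lt_last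
  simp only [layerFactor_eq, Fin.prod_univ_castSucc (n := k), Fin.prod_univ_castSucc (n := N),
    Fin.snoc_castSucc, Fin.snoc_last, hl, Fin.val_castSucc, Fin.val_last, hJ, h₁, h₂, h₃, h₄,
    Fin.is_lt, Fin.castSucc_lt_castSucc_iff, lt_irrefl, if_true, if_false, mul_one, one_mul,
    Finset.prod_mul_distrib, Finset.prod_const_one]
  ring

variable {C : Type*} [DecidableEq C] {d : C} {F : List (ℂ × C) → ℂ}

/-- Induction on the columns from the right. The list `l` serves the induction: it holds the rows
that were already given a colour by columns further right, in the order of those columns; each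
crosses every remaining column with weight e.1 - m i. -/
theorem Exchange.layerWeight_eq_sum (hF : Exchange F) {N r : ℕ} (m : Fin N → ℂ) (c : Fin N → C)
    (J : Fin r → Fin N) (hJ : StrictMono J) (hr : ∀ i, c i ≠ d ↔ i ∈ Set.range J)
    (x : Fin r → ℂ) (hx : Function.Injective x) (l : List (ℂ × C)) (hl : ∀ e ∈ l, e.2 ≠ d) :
    GLPartition.layerWeight d F (List.ofFn fun i => (m i, c i))
        (List.ofFn (fun a => (x a, d)) ++ l)
      = (l.map fun e => ∏ i, (e.1 - m i)).prod
        * ∑ π : Equiv.Perm (Fin r),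
            layerFactor (fun a => x (π a)) m (fun a => J a + 1)
              * F (List.ofFn (fun a => (x (π a), c (J a))) ++ l) := by
  induction N generalizing r l with
  | zero =>
    obtain rfl : r = 0 := by
      by_contra h
      exact (J ⟨0, Nat.pos_of_ne_zero h⟩).elim0
    simp [GLPartition.layerWeight, layerFactor]
  | succ N ih =>
    rw [List.ofFn_succ', List.concat_eq_append, layerWeight_append]
    simp only [GLPartition.layerWeight]
    have hmap : ∀ {s : ℕ} (x : Fin s → ℂ), List.ofFn (fun a => (x a, d))
        = (List.ofFn x).map (·, d) := fun x => by rw [List.map_ofFn]; rfl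
    have hnd : (List.ofFn x).Nodup := List.nodup_ofFn.mpr hx
    have hprod : (l.map fun e => ∏ i, (e.1 - m i)).prod
        = (l.map fun e => ∏ i : Fin N, (e.1 - m i.castSucc)).prod
          * (l.map fun e => e.1 - m (Fin.last N)).prod := by
      simp only [Fin.prod_univ_castSucc, List.prod_map_mul]
    by_cases hlast : c (Fin.last N) = d
    · have hne : ∀ a, J a ≠ Fin.last N := fun a h =>
        (hr (Fin.last N)).mpr ⟨a, h⟩ hlast
      have hlt : ∀ a, (J a : ℕ) < N := fun a => Fin.val_lt_last (hne a)
      have hcast : ∀ a, Fin.castSucc ((J a).castLT (hlt a)) = J a := fun a => rfl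
      rw [hlast, hmap, column_vacuum _ _ _ hl, ← hmap,
        ih (fun i => m i.castSucc) (fun i => c i.castSucc) (fun a => (J a).castLT (hlt a))
          (fun a b h => hJ h) ?_ x hx l hl, hprod]
      · have hsum : ∀ π : Equiv.Perm (Fin r),
            layerFactor (fun a => x (π a)) m (fun a => J a + 1)
              = layerFactor (fun a => x (π a)) (fun i : Fin N => m i.castSucc)
                  (fun a => J a + 1) * ((List.ofFn x).map fun z => z - m (Fin.last N) + 1).prod := by
          intro π
          rw [layerFactor_vacuum _ _ _ hlt, List.map_ofFn, List.prod_ofFn]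
          exact congrArg _ (Equiv.prod_comp π fun a => x a - m (Fin.last N) + 1)
        simp only [hsum, hcast, Fin.val_castLT, Finset.mul_sum]
        exact Finset.sum_congr rfl fun π _ => by ring
      · intro i
        rw [hr]
        constructor
        · rintro ⟨a, ha⟩
          exact ⟨a, Fin.castSucc_injective _ ha⟩
        · rintro ⟨a, ha⟩
          exact ⟨a, by rw [← ha]; rfl⟩
    · obtain ⟨q, hq⟩ := (hr (Fin.last N)).mp hlast
      obtain ⟨r, rfl⟩ : ∃ s, r = s + 1 := Nat.exists_eq_succ_of_ne_zero (Fin.pos q).ne'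
      -- As `J` increases, the last column takes the last index; the row it selects is the image of
      -- that index under the permutation.
      have hJl : J (Fin.last r) = Fin.last N :=
        le_antisymm (Fin.le_last _) (hq ▸ hJ.monotone (Fin.le_last q))
      have hlt : ∀ a : Fin r, (J a.castSucc : ℕ) < N := fun a => by
        have h := hJ (Fin.castSucc_lt_last a)
        rw [hJl] at h
        exact h
      have hcast : ∀ a : Fin r, Fin.castSucc ((J a.castSucc).castLT (hlt a)) = J a.castSucc :=
        fun a => rfl
      have hrange : ∀ i : Fin N, c i.castSucc ≠ d ↔
          i ∈ Set.range fun a : Fin r => (J a.castSucc).castLT (hlt a) := by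
        intro i
        rw [hr]
        constructor
        · rintro ⟨a, ha⟩
          have hal : a ≠ Fin.last r := by
            rintro rfl
            rw [hJl] at ha
            exact (Fin.castSucc_lt_last i).ne ha.symm
          obtain ⟨a, rfl⟩ := Fin.exists_castSucc_eq.mpr hal
          exact ⟨a, Fin.castSucc_injective _ ha⟩
        · rintro ⟨a, ha⟩
          exact ⟨a.castSucc, by rw [← ha]; rfl⟩
      have hl' : ∀ z : ℂ, ∀ e ∈ (z, c (Fin.last N)) :: l, e.2 ≠ d := by
        intro z e he
        rcases List.mem_cons.mp he with rfl | he
        exacts [hlast, hl e he]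
      rw [hmap, (hF.layerWeight _).column_particle hlast hnd hl, sumErase_ofFn, hprod,
        sum_perm_succ (fun z : Fin (r + 1) → ℂ => layerFactor z m (fun a => J a + 1)
          * F (List.ofFn (fun a => (z a, c (J a))) ++ l)) x]
      simp only [← hmap]
      have hsnoc : ∀ (z : ℂ) (w : Fin r → ℂ),
          List.ofFn (fun a => ((Fin.snoc w z : Fin (r + 1) → ℂ) a, c (J a))) ++ l
            = List.ofFn (fun a => (w a, c (J a.castSucc))) ++ (z, c (Fin.last N)) :: l := by
        intro z w
        rw [List.ofFn_succ', List.concat_eq_append]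
        simp [hJl]
      simp only [hsnoc]
      rw [mul_comm (List.prod _) (List.prod _), mul_assoc, Finset.mul_sum (s := Finset.univ),
        Finset.mul_sum (s := Finset.univ), Finset.mul_sum (s := Finset.univ)]
      refine Finset.sum_congr rfl fun i _ => ?_
      rw [ih (fun i => m i.castSucc) (fun i => c i.castSucc)
        (fun a => (J a.castSucc).castLT (hlt a)) (fun a b h => hJ (Fin.castSucc_lt_castSucc_iff.mpr h))
        hrange (fun j => x (i.succAbove j)) (hx.comp Fin.succAbove_right_injective) _ (hl' (x i))]
      have hfac : ∀ π : Equiv.Perm (Fin r),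
          layerFactor (Fin.snoc (fun j => x (i.succAbove (π j))) (x i) : Fin (r + 1) → ℂ) m
              (fun a => J a + 1)
            = layerFactor (fun j => x (i.succAbove (π j))) (fun i : Fin N => m i.castSucc)
                (fun a => J a.castSucc + 1)
              * (∏ i' : Fin N, (x i - m i'.castSucc))
              * ∏ j, ((x (i.succAbove j) - m (Fin.last N) + 1)
                  * ((x i - x (i.succAbove j) + 1) / (x i - x (i.succAbove j)))) := by
        intro π
        rw [layerFactor_particle _ _ _ _ hlt (by rw [hJl]; rfl), mul_assoc (_ * _),
          ← Finset.prod_mul_distrib]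
        refine congrArg _ ?_
        rw [← Equiv.prod_comp π fun j => (x (i.succAbove j) - m (Fin.last N) + 1)
          * ((x i - x (i.succAbove j) + 1) / (x i - x (i.succAbove j)))]
        refine Finset.prod_congr rfl fun j _ => congrArg _ ?_
        -- The weight function has the selected row as second argument of the difference, the column
        -- formula has it as first.
        rw [← neg_div_neg_eq]
        congr 1 <;> ring
      simp only [hfac, hcast, Fin.val_castLT, List.map_cons, List.prod_cons, List.map_ofFn,
        List.prod_ofFn, Function.comp_def]
      simp only [Finset.mul_sum]
      exact Finset.sum_congr rfl fun π _ => by ring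

end LayerSum

/-! ### From products of R-matrices to the column recursion. -/

section Operators

variable {n : ℕ} {S : Shape n}

/-- R = (x - y) + P: the extra 1 on equal colours is the diagonal part of P. -/
theorem R_apply (x y : ℂ) (i j k l : Colour n) :
    R n x y (i, j) (k, l)
      = (x - y) * (if i = k ∧ j = l then 1 else 0) + if i = l ∧ j = k then 1 else 0 := by
  have h₁ : ∀ a : Colour n, (E a a ⊗ₖ E a a) (i, j) (k, l)
      = if a = i then (if a = j ∧ a = k ∧ a = l then 1 else 0 : ℂ) else 0 := by
    intro a
    simp only [E, Matrix.kroneckerMap_apply, Matrix.single_apply]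
    split_ifs <;> grind
  have h₂ : ∀ a b : Colour n, (E a a ⊗ₖ E b b) (i, j) (k, l)
      = if a = i then (if b = j then (if a = k ∧ b = l then 1 else 0 : ℂ) else 0) else 0 := by
    intro a b
    simp only [E, Matrix.kroneckerMap_apply, Matrix.single_apply]
    split_ifs <;> grind
  have h₃ : ∀ a b : Colour n, (E a b ⊗ₖ E b a) (i, j) (k, l)
      = if a = i then (if b = j then (if b = k ∧ a = l then 1 else 0 : ℂ) else 0) else 0 := by
    intro a b
    simp only [E, Matrix.kroneckerMap_apply, Matrix.single_apply]
    split_ifs <;> grind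
  simp only [R, Matrix.add_apply, Matrix.sum_apply, Matrix.smul_apply, h₁, h₂, h₃, smul_eq_mul]
  simp only [Finset.sum_filter]
  have h₄ : ∀ (g : Colour n → Colour n → ℂ),
      (∑ a, ∑ b, if a ≠ b then (if a = i then (if b = j then g a b else 0) else 0) else 0)
        = if i ≠ j then g i j else 0 := by
    intro g
    rw [Finset.sum_eq_single i (fun a _ ha => by simp [ha]) (by simp),
      Finset.sum_eq_single j (fun a _ ha => by simp [ha]) (by simp)]
    simp
  have h₅ := h₄ fun a b => (x - y) * if a = k ∧ b = l then 1 else 0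
  have h₆ := h₄ fun a b => if b = k ∧ a = l then 1 else 0
  simp only [mul_ite, mul_zero] at h₅ ⊢
  rw [h₅, h₆, Finset.sum_ite_eq' Finset.univ i]
  by_cases hij : i = j
  · subst hij
    by_cases hk : i = k <;> by_cases hl : i = l <;> simp [hk, hl] <;> simp_all
  · simp only [Finset.mem_univ, hij, false_and, if_false, ne_eq, not_false_eq_true, if_true,
      zero_add]
    congr 1
    simp only [and_comm]

theorem onLines_mulVec (u v : Line S) (x y : ℂ) (f : (Line S → Colour n) → ℂ)
    (σ : Line S → Colour n) :
    (onLines u v (R n x y)).mulVec f σ = (x - y) * f σ + f (σ ∘ Equiv.swap u v) := by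
  have h : ∀ τ, onLines u v (R n x y) σ τ
      = (x - y) * (if σ = τ then 1 else 0) + if σ ∘ Equiv.swap u v = τ then 1 else 0 := by
    intro τ
    have h₁ : σ = τ ↔ (∀ w, w ≠ u → w ≠ v → σ w = τ w) ∧ σ u = τ u ∧ σ v = τ v := by
      constructor
      · rintro rfl
        simp
      · rintro ⟨h, hu, hv⟩
        funext w
        by_cases hwu : w = u
        · rw [hwu, hu]
        by_cases hwv : w = v
        · rw [hwv, hv]
        exact h w hwu hwv
    have h₂ : σ ∘ Equiv.swap u v = τ ↔
        (∀ w, w ≠ u → w ≠ v → σ w = τ w) ∧ σ u = τ v ∧ σ v = τ u := by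
      constructor
      · rintro rfl
        refine ⟨fun w hu hv => ?_, ?_, ?_⟩
        · simp [Equiv.swap_apply_of_ne_of_ne hu hv]
        · simp
        · simp
      · rintro ⟨h, hu, hv⟩
        funext w
        by_cases hwu : w = u
        · simp [hwu, hv]
        by_cases hwv : w = v
        · simp [hwv, hu]
        simp [Equiv.swap_apply_of_ne_of_ne hwu hwv, h w hwu hwv]
    rw [if_congr h₁ rfl rfl, if_congr h₂ rfl rfl]
    simp only [onLines, Matrix.of_apply, R_apply]
    by_cases h : ∀ w, w ≠ u → w ≠ v → σ w = τ w
    · simp only [eq_true h, true_and, if_true]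
    · simp only [eq_false h, false_and, if_false, mul_zero, add_zero]
  simp only [Matrix.mulVec, dotProduct, h, add_mul, Finset.sum_add_distrib, mul_assoc, ite_mul,
    one_mul, zero_mul, mul_ite, mul_zero]
  simp

/-- The R-matrix of the crossing of a horizontal and a vertical line. -/
def vertexOp (X : Spectral S) (u v : Line S) : Matrix (Line S → Colour n) (Line S → Colour n) ℂ :=
  onLines u v (R n (X.var u) (X.var v))

theorem vertexOp_mulVec (X : Spectral S) (u v : Line S)
    (f : (Line S → Colour n) → ℂ) (σ : Line S → Colour n) :
    (vertexOp X u v).mulVec f σ = (X.var u - X.var v) * f σ + f (σ ∘ Equiv.swap u v) :=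
  onLines_mulVec _ _ _ _ _ _

theorem vertexOp_commute (X : Spectral S) {u v u' v' : Line S}
    (h₁ : u ≠ u') (h₂ : u ≠ v') (h₃ : v ≠ u') (h₄ : v ≠ v') :
    Commute (vertexOp X u v) (vertexOp X u' v') := by
  refine Matrix.mulVec_injective (funext fun f => funext fun σ => ?_)
  rw [← Matrix.mulVec_mulVec, ← Matrix.mulVec_mulVec]
  simp only [vertexOp_mulVec]
  have h : (σ ∘ Equiv.swap u v) ∘ Equiv.swap u' v' = (σ ∘ Equiv.swap u' v') ∘ Equiv.swap u v := by
    rw [Function.comp_assoc, Function.comp_assoc, ← Equiv.Perm.coe_mul, ← Equiv.Perm.coe_mul]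
    congr 2
    refine Equiv.Perm.Disjoint.commute fun w => ?_
    by_cases hw : w = u ∨ w = v
    · right
      rcases hw with rfl | rfl
      · exact Equiv.swap_apply_of_ne_of_ne h₁ h₂
      · exact Equiv.swap_apply_of_ne_of_ne h₃ h₄
    · left
      rw [not_or] at hw
      exact Equiv.swap_apply_of_ne_of_ne hw.1 hw.2
  rw [h]
  ring

theorem prod_map_mul_of_commute {α M : Type*} [Monoid M] (f g : α → M) (l : List α)
    (h : l.Pairwise fun a b => Commute (g a) (f b)) :
    (l.map fun a => f a * g a).prod = (l.map f).prod * (l.map g).prod := by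
  induction l with
  | nil => simp
  | cons a l ih =>
    rw [List.pairwise_cons] at h
    have hc : Commute (g a) (l.map f).prod := by
      refine Commute.list_prod_right _ _ fun z hz => ?_
      obtain ⟨b, hb, rfl⟩ := List.mem_map.mp hz
      exact h.1 b hb
    simp only [List.map_cons, List.prod_cons, ih h.2]
    rw [mul_assoc, ← mul_assoc (g a), hc.eq]
    simp only [mul_assoc]

/-- Turns the row by row order of the lattice into the column by column order of the evaluation;
only vertices sharing neither row nor column have to commute. -/
theorem prod_map_prod_comm {α β M : Type*} [Monoid M] (f : α → β → M) (l : List α) (m : List β)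
    (hl : l.Nodup) (hm : m.Nodup)
    (h : ∀ a ∈ l, ∀ a' ∈ l, a ≠ a' → ∀ b ∈ m, ∀ b' ∈ m, b ≠ b' → Commute (f a b) (f a' b')) :
    (l.map fun a => (m.map fun b => f a b).prod).prod
      = (m.map fun b => (l.map fun a => f a b).prod).prod := by
  induction l with
  | nil => simp
  | cons a l ih =>
    have hl' := List.nodup_cons.mp hl
    simp only [List.map_cons, List.prod_cons]
    rw [ih hl'.2 fun a ha a' ha' => h a (by simp [ha]) a' (by simp [ha']),
      prod_map_mul_of_commute]
    refine hm.pairwise_of_forall_ne fun b hb b' hb' hbb => ?_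
    refine Commute.list_prod_left _ _ fun z hz => ?_
    obtain ⟨a', ha', rfl⟩ := List.mem_map.mp hz
    exact h a' (by simp [ha']) a (by simp) (fun he => hl'.1 (he ▸ ha')) b hb b' hb' hbb

/-- A function of states is supported on states with colour `d` on the line `w`. -/
def SupportedAt (w : Line S) (d : Colour n) (f : (Line S → Colour n) → ℂ) : Prop :=
  ∀ σ, σ w ≠ d → f σ = 0

theorem SupportedAt.vertexOp {w : Line S} {d : Colour n} {f : (Line S → Colour n) → ℂ}
    (hf : SupportedAt w d f) (X : Spectral S) {u v : Line S} (hu : w ≠ u)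
    (hv : w ≠ v) : SupportedAt w d ((vertexOp X u v).mulVec f) := by
  intro σ hσ
  rw [vertexOp_mulVec, hf σ hσ, hf, mul_zero, add_zero]
  simpa [Equiv.swap_apply_of_ne_of_ne hu hv] using hσ

theorem SupportedAt.list_prod {w : Line S} {d : Colour n} {f : (Line S → Colour n) → ℂ}
    (hf : SupportedAt w d f) (L : List (Matrix (Line S → Colour n) (Line S → Colour n) ℂ))
    (h : ∀ A ∈ L, ∀ g, SupportedAt w d g → SupportedAt w d (A.mulVec g)) :
    SupportedAt w d (L.prod.mulVec f) := by
  induction L with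
  | nil => simpa using hf
  | cons A L ih =>
    rw [List.prod_cons, ← Matrix.mulVec_mulVec]
    exact h A (by simp) _ (ih fun B hB => h B (by simp [hB]))

/-- The vertices of the column never change colours elsewhere, so `F` need only describe `f` on
states agreeing with `σ` there. `h₀` expresses that `v` enters with colour `d`. -/
theorem column_mulVec (X : Spectral S) {d : Colour n} (v : Line S) (rows : List (Line S))
    (hrows : rows.Nodup) (hv : v ∉ rows) (f : (Line S → Colour n) → ℂ)
    (F : List (ℂ × Colour n) → ℂ) (σ : Line S → Colour n)
    (h : ∀ σ' : Line S → Colour n, (∀ w, w ∉ rows → w ≠ v → σ' w = σ w) → σ' v = d →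
      f σ' = F (rows.map fun a => (X.var a, σ' a)))
    (h₀ : SupportedAt v d f) :
    ((rows.map fun a => vertexOp X a v).prod).mulVec f σ
      = column d (X.var v) (σ v) F (rows.map fun a => (X.var a, σ a)) := by
  induction rows generalizing F σ with
  | nil =>
    simp only [List.map_nil, List.prod_nil, Matrix.one_mulVec, column]
    split_ifs with hd
    · exact h σ (fun _ _ _ => rfl) hd
    · exact h₀ σ hd
  | cons a rows ih =>
    have hr := List.nodup_cons.mp hrows
    have hva : v ≠ a := fun e => hv (by simp [e])
    have hv' : v ∉ rows := fun e => hv (by simp [e])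
    simp only [List.map_cons, List.prod_cons, column]
    rw [← Matrix.mulVec_mulVec, vertexOp_mulVec,
      ih hr.2 hv' (fun l => F ((X.var a, σ a) :: l)) σ,
      ih hr.2 hv' (fun l => F ((X.var a, σ v) :: l)) (σ ∘ Equiv.swap a v)]
    · have hm : (rows.map fun b => (X.var b, (σ ∘ Equiv.swap a v) b))
          = rows.map fun b => (X.var b, σ b) := by
        refine List.map_congr_left fun b hb => ?_
        have hba : b ≠ a := fun e => hr.1 (e ▸ hb)
        have hbv : b ≠ v := fun e => hv' (e ▸ hb)
        simp [Equiv.swap_apply_of_ne_of_ne hba hbv]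
      rw [hm]
      simp
    · intro σ' hσ' hd
      have ha : σ' a = σ v := by rw [hσ' a hr.1 hva.symm]; simp
      rw [h σ' _ hd, List.map_cons, ha]
      intro w hw hwv
      rw [List.mem_cons, not_or] at hw
      rw [hσ' w hw.2 hwv]
      simp [Equiv.swap_apply_of_ne_of_ne hw.1 hwv]
    · intro σ' hσ' hd
      have ha : σ' a = σ a := hσ' a hr.1 hva.symm
      rw [h σ' _ hd, List.map_cons, ha]
      intro w hw hwv
      rw [List.mem_cons, not_or] at hw
      exact hσ' w hw.2 hwv

theorem columns_mulVec (X : Spectral S) {d : Colour n} (cols rows : List (Line S))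
    (hrows : rows.Nodup) (hcols : cols.Nodup) (hdisj : ∀ v ∈ cols, v ∉ rows)
    (f : (Line S → Colour n) → ℂ) (F : List (ℂ × Colour n) → ℂ) (σ : Line S → Colour n)
    (h : ∀ σ' : Line S → Colour n, (∀ w, w ∉ rows → w ∉ cols → σ' w = σ w) →
      (∀ v ∈ cols, σ' v = d) → f σ' = F (rows.map fun a => (X.var a, σ' a)))
    (h₀ : ∀ v ∈ cols, SupportedAt v d f) :
    ((cols.reverse.map fun v => (rows.map fun a => vertexOp X a v).prod).prod).mulVec f σ
      = layerWeight d F (cols.map fun v => (X.var v, σ v)) (rows.map fun a => (X.var a, σ a)) := by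
  induction cols generalizing f F with
  | nil => simpa [layerWeight] using h σ (fun _ _ _ => rfl) (by simp)
  | cons v cols ih =>
    have hc := List.nodup_cons.mp hcols
    have hd : ∀ v ∈ cols, v ∉ rows := fun v hv => hdisj v (by simp [hv])
    have hv : v ∉ rows := hdisj v (by simp)
    rw [List.reverse_cons, List.map_append, List.prod_append, ← Matrix.mulVec_mulVec]
    simp only [List.map_cons, List.map_nil, List.prod_singleton, layerWeight]
    refine ih hc.2 hd _ _ (fun σ' hσ' hσd => ?_) fun w hw => ?_
    · have hvσ : σ' v = σ v := hσ' v hv hc.1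
      rw [column_mulVec X v rows hrows hv f F σ' _ (h₀ v (by simp)), hvσ]
      intro σ'' hσ'' hσv
      refine h σ'' (fun w hw hwc => ?_) fun w hw => ?_
      · rw [List.mem_cons, not_or] at hwc
        rw [hσ'' w hw hwc.1, hσ' w hw hwc.2]
      · rcases List.mem_cons.mp hw with rfl | hw
        · exact hσv
        · rw [hσ'' w (hd w hw) (fun e => hc.1 (e ▸ hw)), hσd w hw]
    · refine (h₀ w (by simp [hw])).list_prod _ fun A hA g hg => ?_
      obtain ⟨a, ha, rfl⟩ := List.mem_map.mp hA
      exact hg.vertexOp X (fun e => hd w hw (e ▸ ha))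
        (fun e => hc.1 (e ▸ hw))

end Operators

/-! ### The partition function as an iteration over layers. -/

section LowerLayers

variable {n : ℕ} {S : Shape n}

/-- The horizontal lines of a layer, from top to bottom. -/
def rows (S : Shape n) (p : Fin (n + 1)) : List (Line S) :=
  (List.finRange (S.k p)).map (Line.aux p)

theorem mem_rows {p : Fin (n + 1)} {w : Line S} : w ∈ rows S p ↔ ∃ a, w = .aux p a := by
  simp [rows, eq_comm]

theorem columns_last (S : Shape n) : columns S (Fin.last n)
    = (List.finRange S.LM).map fun s => Line.site (Site.top s) := by
  simp [columns]

theorem columns_castSucc (S : Shape n) (q : Fin n) : columns S q.castSucc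
    = ((List.finRange (S.LI q)).map fun s => Line.site (Site.left q s))
        ++ ((List.finRange (S.k q.succ)).map fun a => Line.aux q.succ a)
        ++ ((List.finRange (S.LII q)).map fun s => Line.site (Site.right q s)) := by
  simp [columns]

theorem site_mem_columns {p : Fin (n + 1)} {s : Site S} :
    Line.site s ∈ columns S p ↔ s.layer = p := by
  refine Fin.lastCases ?_ (fun q => ?_) p
  · rw [columns_last]
    cases s with
    | top s => simp [Site.layer]
    | left q s => simp [Site.layer, (Fin.castSucc_lt_last q).ne]
    | right q s => simp [Site.layer, (Fin.castSucc_lt_last q).ne]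
  · rw [columns_castSucc]
    cases s with
    | top s => simp [Site.layer, (Fin.castSucc_lt_last q).ne']
    | left q' s =>
      simp only [List.mem_append, List.mem_map, List.mem_finRange, true_and, Line.site.injEq,
        Site.layer, Fin.castSucc_inj, reduceCtorEq, exists_false, or_false]
      constructor
      · rintro ⟨a, h⟩
        cases h
        rfl
      · rintro rfl
        exact ⟨s, rfl⟩
    | right q' s =>
      simp only [List.mem_append, List.mem_map, List.mem_finRange, true_and, Line.site.injEq,
        Site.layer, Fin.castSucc_inj, reduceCtorEq, exists_false, false_or]
      constructor
      · rintro ⟨a, h⟩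
        cases h
        rfl
      · rintro rfl
        exact ⟨s, rfl⟩

theorem aux_mem_columns {p q : Fin (n + 1)} {a : Fin (S.k q)} :
    Line.aux q a ∈ columns S p ↔ (q : ℕ) = p + 1 := by
  refine Fin.lastCases ?_ (fun r => ?_) p
  · rw [columns_last]
    simp [q.2.ne]
  · rw [columns_castSucc]
    simp only [List.mem_append, List.mem_map, List.mem_finRange, true_and, reduceCtorEq,
      exists_false, or_false, false_or]
    constructor
    · rintro ⟨b, h⟩
      cases h
      rfl
    · intro h
      obtain rfl : q = r.succ := Fin.ext h
      exact ⟨a, rfl⟩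

theorem rows_nodup (p : Fin (n + 1)) : (rows S p).Nodup :=
  (List.nodup_finRange _).map fun a b h => by cases h; rfl

theorem columns_nodup (p : Fin (n + 1)) : (columns S p).Nodup := by
  refine Fin.lastCases ?_ (fun q => ?_) p
  · rw [columns_last]
    exact (List.nodup_finRange _).map fun a b h => by cases h; rfl
  · rw [columns_castSucc, List.append_assoc]
    refine List.Nodup.append ((List.nodup_finRange _).map fun a b h => by cases h; rfl)
      (List.Nodup.append ((List.nodup_finRange _).map fun a b h => by cases h; rfl)
        ((List.nodup_finRange _).map fun a b h => by cases h; rfl) ?_) ?_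
    · intro w hw hw'
      simp only [List.mem_map] at hw hw'
      obtain ⟨a, -, rfl⟩ := hw
      obtain ⟨b, -, hb⟩ := hw'
      cases hb
    · intro w hw hw'
      simp only [List.mem_map, List.mem_append] at hw hw'
      obtain ⟨a, -, rfl⟩ := hw
      rcases hw' with ⟨b, -, hb⟩ | ⟨b, -, hb⟩ <;> cases hb

theorem columns_disjoint_rows {p : Fin (n + 1)} {v : Line S} (hv : v ∈ columns S p) :
    v ∉ rows S p := by
  rw [mem_rows]
  rintro ⟨a, rfl⟩
  rw [aux_mem_columns] at hv
  omega

/-- The product of the R-matrices of one layer. -/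
def layerOp (X : Spectral S) (p : Fin (n + 1)) :
    Matrix (Line S → Colour n) (Line S → Colour n) ℂ :=
  (((columns S p).reverse).map fun v => ((rows S p).map fun a => vertexOp X a v).prod).prod

theorem layerOp_eq (X : Spectral S) (p : Fin (n + 1)) :
    ((layerVertices S p).reverse.map fun g => vertexOp X g.1 g.2).prod = layerOp X p := by
  have h := prod_map_prod_comm (vertexOp X) (rows S p) (columns S p).reverse (rows_nodup p)
    (List.nodup_reverse.mpr (columns_nodup p)) ?_
  · rw [layerOp, ← h, layerVertices, rows, List.reverse_flatMap, List.reverse_reverse,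
      List.map_map, List.map_flatMap, List.flatMap_def, List.prod_flatten, List.map_map]
    congr 1
    refine List.map_congr_left fun a _ => ?_
    simp only [Function.comp_def, ← List.map_reverse, List.map_map]
  · intro a ha a' ha' haa b hb b' hb' hbb
    rw [List.mem_reverse] at hb hb'
    exact vertexOp_commute X haa (fun e => columns_disjoint_rows hb' (e ▸ ha))
      (fun e => columns_disjoint_rows hb (e ▸ ha')) hbb

/-- The state below layer `j`. -/
def stateBelow (X : Spectral S) (j : ℕ) : (Line S → Colour n) → ℂ :=
  ((((List.finRange (n + 1)).take j).reverse.map (layerOp X)).prod).mulVec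
    (Pi.single (inState S) 1)

theorem stateBelow_zero (X : Spectral S) : stateBelow X 0 = Pi.single (inState S) 1 := by
  rw [stateBelow, List.take_zero, List.reverse_nil, List.map_nil, List.prod_nil, Matrix.one_mulVec]

theorem stateBelow_succ (X : Spectral S) (p : Fin (n + 1)) :
    stateBelow X (p + 1) = (layerOp X p).mulVec (stateBelow X p) := by
  rw [stateBelow, stateBelow, List.take_add_one, List.getElem?_eq_getElem (by simpa using p.2),
    List.getElem_finRange, List.reverse_append, List.map_append, List.prod_append,
    ← Matrix.mulVec_mulVec]
  simp only [Option.toList_some, List.reverse_singleton, List.map_singleton, List.prod_singleton]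
  rfl

theorem psi_eq_stateBelow (X : Spectral S) (c : Site S → Colour n) :
    psi X c = stateBelow X (n + 1) (outState c) := by
  rw [psi, stateBelow, Matrix.mulVec_single_one, Matrix.col_apply, latticeOperator]
  rw [vertices, List.reverse_flatMap, List.map_flatMap, List.flatMap_def, List.prod_flatten,
    List.map_map, List.take_of_length_le (by simp)]
  refine congrArg (fun L : List (Matrix _ _ ℂ) => List.prod L (outState c) (inState S)) ?_
  exact List.map_congr_left fun p _ => layerOp_eq X p

/-- A line that no vertex has met yet keeps its incoming colour. -/
theorem supportedAt_stateBelow (X : Spectral S) (w : Line S) (j : ℕ)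
    (hw : ∀ p : Fin (n + 1), (p : ℕ) < j → w ∉ rows S p ∧ w ∉ columns S p) :
    SupportedAt w (inState S w) (stateBelow X j) := by
  refine SupportedAt.list_prod (fun σ hσ => ?_) _ fun A hA g hg => ?_
  · refine Pi.single_eq_of_ne (fun e => hσ ?_) _
    rw [e]
  · rw [List.mem_map] at hA
    obtain ⟨p, hp, rfl⟩ := hA
    rw [List.mem_reverse, List.mem_take_iff_getElem] at hp
    obtain ⟨i, hi, rfl⟩ := hp
    have hw' := hw ((List.finRange (n + 1))[i]'(by omega)) (by simp; omega)
    refine hg.list_prod _ fun B hB g' hg' => ?_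
    obtain ⟨v, hv, rfl⟩ := List.mem_map.mp hB
    refine hg'.list_prod _ fun D hD g'' hg'' => ?_
    obtain ⟨a, ha, rfl⟩ := List.mem_map.mp hD
    exact hg''.vertexOp X (fun e => hw'.1 (e ▸ ha))
      (fun e => hw'.2 (e ▸ List.mem_reverse.mp hv))

/-- The coloured extra columns to the left. -/
def leftColumns (X : Spectral S) (c : Site S → Colour n) (q : Fin n) : List (ℂ × Colour n) :=
  List.ofFn fun s => (X.yI q s, c (.left q s))

/-- The coloured extra columns to the right. -/
def rightColumns (X : Spectral S) (c : Site S → Colour n) (q : Fin n) : List (ℂ × Colour n) :=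
  List.ofFn fun s => (X.yII q s, c (.right q s))

/-- The partition function of the layers below layer `p`, as a function of the variables and colours
of the lines that enter layer `p` from the left. -/
def lowerWeight (X : Spectral S) (c : Site S → Colour n) (p : Fin (n + 1)) :
    List (ℂ × Colour n) → ℂ :=
  Fin.induction (motive := fun _ => List (ℂ × Colour n) → ℂ)
    (fun l => if ∀ e ∈ l, e.2 = 0 then 1 else 0)
    (fun q F l => layerWeight q.castSucc.succ F (leftColumns X c q ++ l ++ rightColumns X c q)
      (List.ofFn fun a => (X.x q.castSucc a, q.castSucc.succ)))
    p

theorem lowerWeight_zero (X : Spectral S) (c : Site S → Colour n) (l : List (ℂ × Colour n)) :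
    lowerWeight X c 0 l = if ∀ e ∈ l, e.2 = 0 then 1 else 0 := rfl

theorem lowerWeight_succ (X : Spectral S) (c : Site S → Colour n) (q : Fin n)
    (l : List (ℂ × Colour n)) :
    lowerWeight X c q.succ l = layerWeight q.castSucc.succ (lowerWeight X c q.castSucc)
      (leftColumns X c q ++ l ++ rightColumns X c q)
      (List.ofFn fun a => (X.x q.castSucc a, q.castSucc.succ)) := rfl

theorem lowerWeight_exchange (X : Spectral S) (c : Site S → Colour n) (p : Fin (n + 1)) :
    Exchange (lowerWeight X c p) := by
  refine Fin.cases ?_ (fun q => ?_) p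
  · exact exchange_indicator 0
  · exact layerWeight_exchange _ _ _ _

/-- The colours of the lines outside layer `p` when the layers below `p` are completed. -/
def partialState (c : Site S → Colour n) (p : Fin (n + 1)) : Line S → Colour n
  | .aux q _ => if q < p then q.succ else q.castSucc
  | .site s => if s.layer < p then c s else s.layer.succ

theorem layerOp_stateBelow (X : Spectral S) (c : Site S → Colour n) (p : Fin (n + 1))
    (h : ∀ σ : Line S → Colour n, (∀ w, w ∉ rows S p → σ w = partialState c p w) →
      stateBelow X p σ = lowerWeight X c p ((rows S p).map fun a => (X.var a, σ a)))
    (σ : Line S → Colour n)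
    (hσ : ∀ w, w ∉ rows S p → w ∉ columns S p → σ w = partialState c p w) :
    stateBelow X (p + 1) σ = layerWeight p.succ (lowerWeight X c p)
      ((columns S p).map fun v => (X.var v, σ v)) ((rows S p).map fun a => (X.var a, σ a)) := by
  have hd : ∀ v ∈ columns S p, partialState c p v = p.succ ∧ inState S v = p.succ := by
    intro v hv
    cases v with
    | aux q a =>
      rw [aux_mem_columns] at hv
      have : ¬ q < p := by rw [Fin.lt_def]; omega
      have : q.castSucc = p.succ := Fin.ext hv
      simp [partialState, inState, *]
    | site s =>
      rw [site_mem_columns] at hv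
      simp [partialState, inState, hv]
  rw [stateBelow_succ, layerOp]
  refine columns_mulVec X _ _ (rows_nodup p) (columns_nodup p) (fun v => columns_disjoint_rows)
    _ _ σ (fun σ' hσ' hσd => h σ' fun w hw => ?_) fun v hv => ?_
  · by_cases hwc : w ∈ columns S p
    · rw [hσd w hwc, (hd w hwc).1]
    · rw [hσ' w hw hwc, hσ w hw hwc]
  · rw [← (hd v hv).2]
    refine supportedAt_stateBelow X v p fun q hq => ?_
    cases v with
    | aux r a =>
      rw [aux_mem_columns] at hv ⊢
      refine ⟨fun hr => ?_, by omega⟩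
      obtain ⟨b, hb⟩ := mem_rows.mp hr
      cases hb
      omega
    | site s =>
      rw [site_mem_columns] at hv ⊢
      refine ⟨fun hr => ?_, ?_⟩
      · obtain ⟨b, hb⟩ := mem_rows.mp hr
        cases hb
      · rintro rfl
        exact hq.ne (congrArg Fin.val hv)

/-- Later layers do not touch finished lines, so these may be fixed at their final colours and
unstarted ones at their incoming colours; only the rows of layer `p` stay free. -/
theorem stateBelow_eq_lowerWeight (X : Spectral S) (c : Site S → Colour n) (p : Fin (n + 1)) :
    ∀ σ : Line S → Colour n, (∀ w, w ∉ rows S p → σ w = partialState c p w) →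
      stateBelow X p σ = lowerWeight X c p ((rows S p).map fun a => (X.var a, σ a)) := by
  induction p using Fin.induction with
  | zero =>
    intro σ hσ
    rw [Fin.val_zero, stateBelow_zero, lowerWeight_zero, Pi.single_apply]
    refine if_congr ?_ rfl rfl
    simp only [List.mem_map, forall_exists_index, and_imp, forall_apply_eq_imp_iff₂]
    constructor
    · rintro rfl a ha
      obtain ⟨b, rfl⟩ := mem_rows.mp ha
      rfl
    · intro h
      funext w
      by_cases hw : w ∈ rows S 0
      · rw [h w hw]
        obtain ⟨b, rfl⟩ := mem_rows.mp hw
        rfl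
      · rw [hσ w hw]
        cases w <;> simp [partialState, inState]
  | succ q ih =>
    intro σ hσ
    have haux : ∀ a, σ (.aux q.castSucc a) = q.castSucc.succ := by
      intro a
      rw [hσ _ fun h => ?_]
      · simp [partialState]
      · obtain ⟨b, hb⟩ := mem_rows.mp h
        have := congrArg (fun w : Line S => match w with | .aux r _ => (r : ℕ) | .site _ => 0) hb
        simp at this
    have hsite : ∀ s : Site S, s.layer = q.castSucc → σ (.site s) = c s := by
      intro s hs
      rw [hσ _ fun h => ?_]
      · simp [partialState, hs]
      · obtain ⟨b, hb⟩ := mem_rows.mp h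
        cases hb
    have hs : ((q.succ : Fin (n + 1)) : ℕ) = (q.castSucc : Fin (n + 1)) + 1 := by simp
    rw [hs, layerOp_stateBelow X c q.castSucc ih σ, lowerWeight_succ]
    · congr 1
      · rw [columns_castSucc]
        simp only [List.map_append, List.map_map, leftColumns, rightColumns, List.ofFn_eq_map,
          rows]
        congr 1
        · congr 1
          refine List.map_congr_left fun s _ => ?_
          simp [hsite (.left q s) rfl, Spectral.var]
        · refine List.map_congr_left fun s _ => ?_
          simp [hsite (.right q s) rfl, Spectral.var]
      · rw [rows, List.map_map, List.ofFn_eq_map]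
        refine List.map_congr_left fun a _ => ?_
        simp [haux, Spectral.var]
    · intro w hw hwc
      cases w with
      | aux r a =>
        rw [aux_mem_columns] at hwc
        have h₁ : r ≠ q.succ := by
          rintro rfl
          exact hwc (by simp)
        have h₂ : r ≠ q.castSucc := by
          rintro rfl
          exact hw (mem_rows.mpr ⟨a, rfl⟩)
        rw [hσ _ fun h => ?_]
        · have h₃ : (r : ℕ) ≠ q := fun e => h₂ (Fin.ext e)
          have : r < q.succ ↔ r < q.castSucc := by
            simp only [Fin.lt_def, Fin.val_succ, Fin.val_castSucc]
            omega
          simp [partialState, this]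
        · obtain ⟨b, hb⟩ := mem_rows.mp h
          cases hb
          exact h₁ rfl
      | site s =>
        rw [site_mem_columns] at hwc
        rw [hσ _ fun h => ?_]
        · have h₃ : (s.layer : ℕ) ≠ q := fun e => hwc (Fin.ext e)
          have : s.layer < q.succ ↔ s.layer < q.castSucc := by
            simp only [Fin.lt_def, Fin.val_succ, Fin.val_castSucc]
            omega
          simp [partialState, this]
        · obtain ⟨b, hb⟩ := mem_rows.mp h
          cases hb

theorem psi_eq_layerWeight (X : Spectral S) (c : Site S → Colour n) :
    psi X c = layerWeight (Fin.last n).succ (lowerWeight X c (Fin.last n))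
      (List.ofFn fun s => (X.y s, c (.top s)))
      (List.ofFn fun a => (X.x (Fin.last n) a, (Fin.last n).succ)) := by
  have h := layerOp_stateBelow X c (Fin.last n)
    (stateBelow_eq_lowerWeight X c (Fin.last n)) (outState c) ?_
  · rw [psi_eq_stateBelow]
    refine h.trans ?_
    rw [columns_last, rows, List.map_map, List.map_map, List.ofFn_eq_map, List.ofFn_eq_map]
    rfl
  · intro w hw hwc
    cases w with
    | aux r a =>
      have h₁ : r ≠ Fin.last n := by
        rintro rfl
        exact hw (mem_rows.mpr ⟨a, rfl⟩)
      simp [partialState, outState, Fin.lt_last_iff_ne_last.mpr h₁]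
    | site s =>
      rw [site_mem_columns] at hwc
      simp [partialState, outState, Fin.lt_last_iff_ne_last.mpr hwc]

end LowerLayers

/-! ### Label sets as column positions, and the assembly of the nested sums. -/

section Labels

variable {n : ℕ} {S : Shape n}

theorem nthElement_image {k : ℕ} (f : Fin k → ℕ) (hf : StrictMono f) (a : Fin k) :
    nthElement (Finset.univ.image f) a = f a := by
  have h : Nat.count (fun t => t ∈ Finset.univ.image f) (f a) = a := by
    rw [Nat.count_eq_card_filter_range]
    have : (Finset.range (f a)).filter (fun t => t ∈ Finset.univ.image f)
        = (Finset.Iio a).image f := by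
      ext t
      simp only [Finset.mem_filter, Finset.mem_range, Finset.mem_image, Finset.mem_univ, true_and,
        Finset.mem_Iio]
      constructor
      · rintro ⟨h, b, rfl⟩
        exact ⟨b, hf.lt_iff_lt.mp h, rfl⟩
      · rintro ⟨b, h, rfl⟩
        exact ⟨hf h, b, rfl⟩
    rw [this, Finset.card_image_of_injective _ hf.injective, Fin.card_Iio]
  rw [nthElement]
  nth_rewrite 1 [← h]
  exact Nat.nth_count (p := fun t => t ∈ Finset.univ.image f) (by simp)

theorem sum_Iio_add_le {f : Fin n → ℕ} {q q' : Fin n} (h : q < q') :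
    ∑ i ∈ Finset.Iio q, f i + f q ≤ ∑ i ∈ Finset.Iio q', f i := by
  rw [add_comm, ← Finset.sum_insert (by simp)]
  refine Finset.sum_le_sum_of_subset fun i hi => ?_
  rw [Finset.mem_insert, Finset.mem_Iio] at hi
  rw [Finset.mem_Iio]
  rcases hi with rfl | hi
  exacts [h, hi.trans h]

theorem sum_Iio_add_le_univ (f : Fin n → ℕ) (q : Fin n) :
    ∑ i ∈ Finset.Iio q, f i + f q ≤ ∑ i, f i := by
  rw [add_comm, ← Finset.sum_insert (by simp)]
  exact Finset.sum_le_sum_of_subset (Finset.subset_univ _)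

theorem sum_Ioi_add_le {f : Fin n → ℕ} {q q' : Fin n} (h : q < q') :
    ∑ i ∈ Finset.Ioi q', f i + f q' ≤ ∑ i ∈ Finset.Ioi q, f i := by
  rw [add_comm, ← Finset.sum_insert (by simp)]
  refine Finset.sum_le_sum_of_subset fun i hi => ?_
  rw [Finset.mem_insert, Finset.mem_Ioi] at hi
  rw [Finset.mem_Ioi]
  rcases hi with rfl | hi
  exacts [h, h.trans hi]

/-- The sites of the layers above layer `q` lie between the left and the right sites of `q`. -/
theorem coord_bounds {q : Fin n} {t : Site S} (ht : q.castSucc < t.layer) :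
    ∑ i ∈ Finset.Iio q, S.LI i + S.LI q < t.coord ∧
      t.coord ≤ ∑ i, S.LI i + S.LM + ∑ i ∈ Finset.Ioi q, S.LII i := by
  have h₁ := sum_Iio_add_le_univ S.LI q
  cases t with
  | left p s =>
    have hp : q < p := ht
    have h₂ := sum_Iio_add_le (f := S.LI) hp
    have h₃ := sum_Iio_add_le_univ S.LI p
    have := s.2
    simp only [Site.coord]
    omega
  | top s =>
    have := s.2
    simp only [Site.coord]
    omega
  | right p s =>
    have hp : q < p := ht
    have h₂ := sum_Ioi_add_le (f := S.LII) hp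
    have := s.2
    simp only [Site.coord]
    omega

theorem coord_ne_of_layer_lt {t t' : Site S} (h : t.layer < t'.layer) : t.coord ≠ t'.coord := by
  cases t with
  | left p s =>
    have h₁ := (coord_bounds (q := p) h).1
    have := s.2
    simp only [Site.coord] at h₁ ⊢
    omega
  | top s => exact absurd h (Fin.le_last _).not_gt
  | right p s =>
    have h₁ := (coord_bounds (q := p) h).2
    simp only [Site.coord] at h₁ ⊢
    omega

theorem coord_left_lt_right (q : Fin n) (s : Fin (S.LI q)) (s' : Fin (S.LII q)) :
    (Site.left q s : Site S).coord < (Site.right q s' : Site S).coord := by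
  have h := sum_Iio_add_le_univ S.LI q
  have := s.2
  simp only [Site.coord]
  omega

theorem coord_injective : Function.Injective (Site.coord (S := S)) := by
  intro t t' h
  rcases lt_trichotomy t.layer t'.layer with hl | hl | hl
  · exact absurd h (coord_ne_of_layer_lt hl)
  · cases t with
    | left p s =>
      cases t' with
      | left p' s' =>
        obtain rfl : p = p' := Fin.castSucc_injective _ hl
        simp only [Site.coord] at h
        rw [show s = s' from Fin.ext (by omega)]
      | top s' => exact absurd hl (Fin.castSucc_lt_last p).ne
      | right p' s' =>
        obtain rfl : p = p' := Fin.castSucc_injective _ hl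
        exact absurd h (coord_left_lt_right p s s').ne
    | top s =>
      cases t' with
      | left p' s' => exact absurd hl (Fin.castSucc_lt_last p').ne'
      | top s' =>
        simp only [Site.coord] at h
        rw [show s = s' from Fin.ext (by omega)]
      | right p' s' => exact absurd hl (Fin.castSucc_lt_last p').ne'
    | right p s =>
      cases t' with
      | left p' s' =>
        obtain rfl : p = p' := Fin.castSucc_injective _ hl
        exact absurd h (coord_left_lt_right p s' s).ne'
      | top s' => exact absurd hl (Fin.castSucc_lt_last p).ne
      | right p' s' =>
        obtain rfl : p = p' := Fin.castSucc_injective _ hl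
        simp only [Site.coord] at h
        rw [show s = s' from Fin.ext (by omega)]
  · exact absurd h.symm (coord_ne_of_layer_lt hl)

theorem mem_labelSet {c : Site S → Colour n} {p : Fin (n + 1)} {t : ℕ} :
    t ∈ labelSet c p ↔ ∃ s : Site S, (p ≤ s.layer ∧ c s ≤ p.castSucc) ∧ s.coord = t := by
  simp [labelSet]

theorem exists_site {c : Site S → Colour n} (hc : Admissible c) (p : Fin (n + 1))
    (a : Fin (S.k p)) : ∃ s : Site S, (p ≤ s.layer ∧ c s ≤ p.castSucc) ∧
      s.coord = (labelSet c p).orderEmbOfFin (hc.card_labelSet p) a :=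
  mem_labelSet.mp (Finset.orderEmbOfFin_mem _ _ _)

/-- The sites that are counted by `labelSet c p`, in increasing order. -/
def labelSite {c : Site S → Colour n} (hc : Admissible c) (p : Fin (n + 1)) (a : Fin (S.k p)) :
    Site S :=
  (exists_site hc p a).choose

variable {c : Site S → Colour n} (hc : Admissible c)

theorem layer_labelSite (p : Fin (n + 1)) (a : Fin (S.k p)) : p ≤ (labelSite hc p a).layer :=
  (exists_site hc p a).choose_spec.1.1

theorem colour_labelSite (p : Fin (n + 1)) (a : Fin (S.k p)) :
    c (labelSite hc p a) ≤ p.castSucc :=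
  (exists_site hc p a).choose_spec.1.2

theorem coord_labelSite (p : Fin (n + 1)) (a : Fin (S.k p)) :
    (labelSite hc p a).coord = (labelSet c p).orderEmbOfFin (hc.card_labelSet p) a :=
  (exists_site hc p a).choose_spec.2

theorem coord_labelSite_strictMono (p : Fin (n + 1)) :
    StrictMono fun a => (labelSite hc p a).coord := by
  intro a b h
  simpa only [coord_labelSite, OrderEmbedding.lt_iff_lt] using h

theorem exists_labelSite_eq {p : Fin (n + 1)} {s : Site S} (h₁ : p ≤ s.layer)
    (h₂ : c s ≤ p.castSucc) : ∃ a, labelSite hc p a = s := by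
  have h : s.coord ∈ Set.range ((labelSet c p).orderEmbOfFin (hc.card_labelSet p)) := by
    rw [Finset.range_orderEmbOfFin]
    exact mem_labelSet.mpr ⟨s, ⟨h₁, h₂⟩, rfl⟩
  obtain ⟨a, ha⟩ := h
  exact ⟨a, coord_injective (by rw [coord_labelSite, ha])⟩

theorem labelSet_eq_image (p : Fin (n + 1)) :
    labelSet c p = Finset.univ.image fun a => (labelSite hc p a).coord := by
  ext t
  rw [mem_labelSet, Finset.mem_image]
  constructor
  · rintro ⟨s, ⟨h₁, h₂⟩, rfl⟩
    obtain ⟨a, rfl⟩ := exists_labelSite_eq hc h₁ h₂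
    exact ⟨a, Finset.mem_univ _, rfl⟩
  · rintro ⟨a, -, rfl⟩
    exact ⟨_, ⟨layer_labelSite hc p a, colour_labelSite hc p a⟩, rfl⟩

theorem nthElement_labelSet (p : Fin (n + 1)) (a : Fin (S.k p)) :
    nthElement (labelSet c p) a = (labelSite hc p a).coord := by
  rw [labelSet_eq_image hc]
  exact nthElement_image _ (coord_labelSite_strictMono hc p) a

/-- Positions of the labelled sites in an ordered enumeration of the kept sites. -/
theorem exists_positions (p : Fin (n + 1)) {N : ℕ} (e : Fin N → Site S)
    (he : StrictMono fun i => (e i).coord)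
    (hmem : ∀ s, s ∈ Set.range e ↔ p ≤ s.layer ∧ c s ≤ p.succ) :
    ∃ J : Fin (S.k p) → Fin N, StrictMono J ∧ (∀ i, c (e i) ≠ p.succ ↔ i ∈ Set.range J) ∧
      (∀ a, e (J a) = labelSite hc p a) ∧
      ∀ a : Fin (S.k p), nthElement (inducedSet c p) a = J a + 1 := by
  have hex : ∀ a, ∃ i, e i = labelSite hc p a := fun a =>
    (hmem _).mpr ⟨layer_labelSite hc p a,
      (colour_labelSite hc p a).trans (Fin.castSucc_lt_succ (i := p)).le⟩
  choose J hJ using hex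
  have hmono : StrictMono J := by
    intro a b h
    have h' := coord_labelSite_strictMono hc p h
    simp only [← hJ] at h'
    exact he.lt_iff_lt.mp h'
  refine ⟨J, hmono, fun i => ?_, hJ, fun a => ?_⟩
  · have hi := (hmem (e i)).mp ⟨i, rfl⟩
    constructor
    · intro h
      have hle : c (e i) ≤ p.castSucc := by
        have := lt_of_le_of_ne hi.2 h
        rw [Fin.lt_def, Fin.val_succ] at this
        rw [Fin.le_def, Fin.val_castSucc]
        omega
      obtain ⟨a, ha⟩ := exists_labelSite_eq hc hi.1 hle
      rw [← hJ] at ha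
      exact ⟨a, he.injective (congrArg Site.coord ha)⟩
    · rintro ⟨a, rfl⟩
      rw [hJ]
      exact ((colour_labelSite hc p a).trans_lt Fin.castSucc_lt_succ).ne
  · have hkept : keptSet c p = Finset.univ.image fun i => (e i).coord := by
      ext t
      simp only [keptSet, Finset.mem_image, Finset.mem_filter, Finset.mem_univ, true_and, ← hmem]
      constructor
      · rintro ⟨_, ⟨i, rfl⟩, rfl⟩
        exact ⟨i, rfl⟩
      · rintro ⟨i, rfl⟩
        exact ⟨_, ⟨i, rfl⟩, rfl⟩
    -- Relabelling is the rank in the increasing enumeration, counted from 1.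
    have hcard : ∀ i, ((keptSet c p).filter fun u => u ≤ (e i).coord).card = i + 1 := by
      intro i
      have : ((keptSet c p).filter fun u => u ≤ (e i).coord)
          = (Finset.Iic i).image fun i => (e i).coord := by
        ext t
        simp only [hkept, Finset.mem_filter, Finset.mem_image, Finset.mem_univ, true_and,
          Finset.mem_Iic]
        constructor
        · rintro ⟨⟨j, rfl⟩, h⟩
          exact ⟨j, he.le_iff_le.mp h, rfl⟩
        · rintro ⟨j, h, rfl⟩
          exact ⟨⟨j, rfl⟩, he.le_iff_le.mpr h⟩
      rw [this, Finset.card_image_of_injective _ he.injective, Fin.card_Iic]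
    have hind : inducedSet c p = Finset.univ.image fun a => (J a : ℕ) + 1 := by
      rw [inducedSet, labelSet_eq_image hc, Finset.image_image]
      refine Finset.image_congr fun a _ => ?_
      simp only [Function.comp_apply, ← hJ, hcard]
    rw [hind]
    exact nthElement_image (fun a => (J a : ℕ) + 1)
      (fun a b h => Nat.succ_lt_succ (hmono h)) a

/-- The kept sites of layer `q`, in increasing order. -/
def keptSite (q : Fin n) : Fin (S.LI q + S.k q.succ + S.LII q) → Site S :=
  Fin.append (Fin.append (Site.left q) (labelSite hc q.succ)) (Site.right q)

theorem layer_labelSite_succ (q : Fin n) (a : Fin (S.k q.succ)) :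
    q.castSucc < (labelSite hc q.succ a).layer :=
  Fin.castSucc_lt_succ.trans_le (layer_labelSite hc q.succ a)

theorem coord_keptSite_strictMono (q : Fin n) : StrictMono fun i => (keptSite hc q i).coord := by
  intro i j h
  induction i using Fin.addCases with
  | left i =>
    induction i using Fin.addCases with
    | left i =>
      induction j using Fin.addCases with
      | left j =>
        induction j using Fin.addCases with
        | left j =>
          simp only [Fin.lt_def, Fin.val_castAdd] at h
          simp only [keptSite, Fin.append_left, Site.coord]
          omega
        | right j =>
          have h₁ := (coord_bounds (layer_labelSite_succ hc q j)).1
          have := i.2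
          simp only [keptSite, Fin.append_left, Fin.append_right]
          simp only [Site.coord] at h₁ ⊢
          omega
      | right j =>
        simpa only [keptSite, Fin.append_left, Fin.append_right] using coord_left_lt_right q i j
    | right i =>
      induction j using Fin.addCases with
      | left j =>
        induction j using Fin.addCases with
        | left j =>
          simp only [Fin.lt_def, Fin.val_castAdd, Fin.val_natAdd] at h
          omega
        | right j =>
          simp only [keptSite, Fin.append_left, Fin.append_right]
          refine coord_labelSite_strictMono hc _ ?_
          simp only [Fin.lt_def, Fin.val_castAdd, Fin.val_natAdd] at h
          exact Fin.lt_def.mpr (by omega)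
      | right j =>
        have h₁ := (coord_bounds (layer_labelSite_succ hc q i)).2
        simp only [keptSite, Fin.append_left, Fin.append_right]
        simp only [Site.coord] at h₁ ⊢
        omega
  | right i =>
    induction j using Fin.addCases with
    | left j =>
      simp only [Fin.lt_def, Fin.val_castAdd, Fin.val_natAdd] at h
      omega
    | right j =>
      simp only [Fin.lt_def, Fin.val_natAdd] at h
      simp only [keptSite, Fin.append_right, Site.coord]
      omega

/-- Every site of layer `q` is kept, by `colour_le`; a kept site of a higher layer belongs to the
next label set. Thus the kept sites match the columns of layer `q`, the rows of the next layer
standing for its labelled sites. -/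
theorem mem_range_keptSite (q : Fin n) (s : Site S) :
    s ∈ Set.range (keptSite hc q) ↔ q.castSucc ≤ s.layer ∧ c s ≤ q.castSucc.succ := by
  constructor
  · rintro ⟨i, rfl⟩
    induction i using Fin.addCases with
    | left i =>
      induction i using Fin.addCases with
      | left i =>
        simp only [keptSite, Fin.append_left]
        exact ⟨le_rfl, hc.colour_le _⟩
      | right i =>
        simp only [keptSite, Fin.append_left, Fin.append_right]
        exact ⟨(layer_labelSite_succ hc q i).le, colour_labelSite hc q.succ i⟩
    | right i =>
      simp only [keptSite, Fin.append_right]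
      exact ⟨le_rfl, hc.colour_le _⟩
  · rintro ⟨h₁, h₂⟩
    rcases h₁.eq_or_lt with h | h
    · cases s with
      | left p s =>
        obtain rfl : q = p := Fin.castSucc_injective _ h
        exact ⟨Fin.castAdd _ (Fin.castAdd _ s), by simp [keptSite]⟩
      | top s => exact absurd h (Fin.castSucc_lt_last q).ne
      | right p s =>
        obtain rfl : q = p := Fin.castSucc_injective _ h
        exact ⟨Fin.natAdd _ s, by simp [keptSite]⟩
    · obtain ⟨a, rfl⟩ := exists_labelSite_eq hc (p := q.succ) (Fin.castSucc_lt_iff_succ_le.mp h) h₂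
      exact ⟨Fin.castAdd _ (Fin.natAdd _ a), by simp [keptSite]⟩

theorem lowerWeight_zero_labelSite (X : Spectral S) (z : Fin (S.k 0) → ℂ) :
    lowerWeight X c 0 (List.ofFn fun a => (z a, c (labelSite hc 0 a))) = 1 := by
  rw [lowerWeight_zero, if_pos]
  intro e he
  obtain ⟨a, rfl⟩ := (List.mem_ofFn' _ _).mp he
  exact le_antisymm (colour_labelSite hc 0 a) (Fin.zero_le _)

/-- One step of the nesting, used with `z` a permutation of the rows of layer `q.succ`. The columns
then carry the colours of the kept sites, and the columns not ending with the incoming colour are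
the labelled sites of layer `q`. -/
theorem lowerWeight_succ_labelSite {X : Spectral S} (hX : ∀ p, Function.Injective (X.x p))
    (q : Fin n) (z : Fin (S.k q.succ) → ℂ) :
    lowerWeight X c q.succ (List.ofFn fun a => (z a, c (labelSite hc q.succ a)))
      = ∑ π : Equiv.Perm (Fin (S.k q.castSucc)),
          layerFactor (fun a => X.x q.castSucc (π a))
              (Fin.append (Fin.append (X.yI q) z) (X.yII q))
              (fun a => nthElement (inducedSet c q.castSucc) a)
            * lowerWeight X c q.castSucc
                (List.ofFn fun a => (X.x q.castSucc (π a), c (labelSite hc q.castSucc a))) := by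
  obtain ⟨J, hJ, hr, he, hn⟩ := exists_positions hc q.castSucc (keptSite hc q)
    (coord_keptSite_strictMono hc q) (mem_range_keptSite hc q)
  have h := (lowerWeight_exchange X c q.castSucc).layerWeight_eq_sum
    (Fin.append (Fin.append (X.yI q) z) (X.yII q)) (fun i => c (keptSite hc q i)) J hJ hr
    (X.x q.castSucc) (hX _) [] (by simp)
  have hl : leftColumns X c q ++ (List.ofFn fun a => (z a, c (labelSite hc q.succ a)))
        ++ rightColumns X c q
      = List.ofFn fun i => (Fin.append (Fin.append (X.yI q) z) (X.yII q) i,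
          c (keptSite hc q i)) := by
    rw [leftColumns, rightColumns, ← List.ofFn_fin_append, ← List.ofFn_fin_append]
    congr 1
    funext i
    induction i using Fin.addCases with
    | left i =>
      induction i using Fin.addCases with
      | left i => simp [keptSite]
      | right i => simp [keptSite]
    | right i => simp [keptSite]
  rw [lowerWeight_succ, hl]
  simpa only [List.append_nil, List.map_nil, List.prod_nil, one_mul, he, ← hn] using h

theorem psi_eq_sum {X : Spectral S} (hX : ∀ p, Function.Injective (X.x p)) :
    psi X c = ∑ π : Equiv.Perm (Fin (S.k (Fin.last n))),
      layerFactor (fun a => X.x (Fin.last n) (π a)) X.y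
          (fun a => nthElement (labelSet c (Fin.last n)) a - ∑ q, S.LI q)
        * lowerWeight X c (Fin.last n)
            (List.ofFn fun a => (X.x (Fin.last n) (π a), c (labelSite hc (Fin.last n) a))) := by
  obtain ⟨J, hJ, hr, he, -⟩ := exists_positions hc (Fin.last n) (Site.top (S := S))
    (fun i j h => by simpa [Site.coord] using h) (fun s => by
      constructor
      · rintro ⟨i, rfl⟩
        exact ⟨le_rfl, hc.colour_le _⟩
      · rintro ⟨h, -⟩
        cases s with
        | left p s => exact absurd h (Fin.castSucc_lt_last p).not_ge
        | top s => exact ⟨s, rfl⟩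
        | right p s => exact absurd h (Fin.castSucc_lt_last p).not_ge)
  have h := (lowerWeight_exchange X c (Fin.last n)).layerWeight_eq_sum X.y
    (fun i => c (Site.top i)) J hJ hr (X.x (Fin.last n)) (hX _) [] (by simp)
  -- Labelled sites of the top layer come after all left sites, so the truncated subtraction is
  -- exact.
  have hn : ∀ a : Fin (S.k (Fin.last n)), nthElement (labelSet c (Fin.last n)) a - ∑ q, S.LI q = J a + 1 := by
    intro a
    rw [nthElement_labelSet hc, ← he, Site.coord]
    omega
  rw [psi_eq_layerWeight]
  simpa only [List.append_nil, List.map_nil, List.prod_nil, one_mul, he, ← hn] using h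

/-- A transfer-matrix expansion: consecutive layers are coupled only through neighbouring
permutations. -/
theorem sum_chain {n : ℕ} (A : Fin (n + 1) → Type*) [∀ p, Fintype (A p)]
    [Fintype (∀ p, A p)]
    (f : ∀ q : Fin n, A q.castSucc → A q.succ → ℂ) (H : ∀ p, A p → ℂ)
    (h₀ : ∀ a, H 0 a = 1)
    (hs : ∀ q b, H (Fin.succ q) b = ∑ a, f q a b * H q.castSucc a) (g : A (Fin.last n) → ℂ) :
    ∑ σ : ∀ p, A p, (∏ q, f q (σ q.castSucc) (σ q.succ)) * g (σ (Fin.last n))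
      = ∑ b, g b * H (Fin.last n) b := by
  classical
  induction n with
  | zero =>
    refine Fintype.sum_equiv (Equiv.piUnique (α := Fin 1) A) _ _ fun σ => ?_
    have h : H (Fin.last 0) (σ (Fin.last 0)) = 1 := h₀ (σ 0)
    rw [Finset.univ_eq_empty, Finset.prod_empty, one_mul]
    exact (mul_one _).symm.trans (congrArg _ h.symm)
  | succ n ih =>
    -- The sum over the top variable is absorbed into a new boundary function.
    have h := ih (fun p => A p.castSucc) (fun q => f q.castSucc) (fun p => H p.castSucc) h₀
      (fun q => hs q.castSucc) (fun a => ∑ b, f (Fin.last n) a b * g b)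
    rw [← Fintype.sum_equiv (Fin.snocEquiv A) _ _ fun _ => rfl, Fintype.sum_prod_type_right]
    refine Eq.trans (Finset.sum_congr rfl fun σ _ => ?_) (h.trans ?_)
    · rw [Finset.mul_sum]
      refine Finset.sum_congr rfl fun b _ => ?_
      rw [Fin.prod_univ_castSucc, ← mul_assoc]
      simp only [Fin.snocEquiv, Equiv.coe_fn_mk, Fin.snoc_last, Fin.snoc_castSucc]
      have e₁ : ∀ i : Fin n, (Fin.snoc σ b : ∀ p, A p) i.castSucc.succ = σ i.succ :=
        fun i => Fin.snoc_castSucc (α := A) b σ i.succ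
      have e₂ : (Fin.snoc σ b : ∀ p, A p) (Fin.last n).succ = b := Fin.snoc_last (α := A) b σ
      simp only [e₁, e₂]
    · have hl := hs (Fin.last n)
      simp only [Fin.succ_last] at hl
      simp only [hl, Finset.mul_sum, Finset.sum_mul]
      rw [Finset.sum_comm]
      exact Finset.sum_congr rfl fun b _ => Finset.sum_congr rfl fun a _ => by ring

end Labels

end GLPartition

end

theorem mainTheorem1 {n : ℕ} (S : GLPartition.Shape n) (X : GLPartition.Spectral S)
    (hX : ∀ p, Function.Injective (X.x p))
    (c : GLPartition.Site S → GLPartition.Colour n) (hc : GLPartition.Admissible c) :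
    GLPartition.psi X c = GLPartition.weightFunction X c := by
  open GLPartition in
  rw [psi_eq_sum hc hX, weightFunction]
  -- Here `H p π` is the weight of the layers below `p`, its lines listed in the order `π` with the
  -- colours of the labelled sites.
  refine (sum_chain (fun p => Equiv.Perm (Fin (S.k p)))
    (fun p π ρ => layerFactor (fun a => X.x p.castSucc (π a))
      (Fin.append (Fin.append (X.yI p) (fun b => X.x p.succ (ρ b))) (X.yII p))
      (fun a => nthElement (inducedSet c p.castSucc) a))
    (fun p π => lowerWeight X c p (List.ofFn fun a => (X.x p (π a), c (labelSite hc p a))))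
    (fun π => lowerWeight_zero_labelSite hc X _)
    (fun q ρ => lowerWeight_succ_labelSite hc hX q _)
    (fun π => layerFactor (fun a => X.x (Fin.last n) (π a)) X.y
      (fun a => nthElement (labelSet c (Fin.last n)) a - ∑ q, S.LI q))).symm
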